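/- Setting. Let $\mathcal A$ be a labeled priced timed automaton with a single clock $x$ with values in $\mathbb R_{\ge 0}$: it has finitely many locations and transitions; guards and invariants are conjunctions of constraints $x\sim c$ with $c\in\mathbb N$ and $\sim\;\in\{<,\le,=,\ge,>\}$; a labeling of locations by sets of atomic propositions; and finitely many cost functions $\mathrm{cost}_1,\dots,\mathrm{cost}_p$ with values in $\mathbb N$, each giving a rate to every location and a discrete cost to every transition. An infinite run is an infinite sequence of mixed moves; a mixed move is a delay $t\ge0$ in the current location (the invariant holding throughout the delay; its $i$-th cost is $t$ times the $i$-th rate of that location), followed by a transition (whose guard holds before it and whose target invariant holds after it; its $i$-th cost is the discrete cost). WCTL formulas are $$\varphi ::= a\mid\neg\varphi\mid\varphi\vee\varphi\mid \mathbf E\,\varphi\,\mathbf U_{\mathrm{cost}_i\sim c}\,\varphi\mid \mathbf A\,\varphi\,\mathbf U_{\mathrm{cost}_i\sim c}\,\varphi\qquad(c\in\mathbb N).$$ They are evaluated at configurations $(q,x)$, where $\mathbf E$ (resp. $\mathbf A$) quantifies over some (resp. all) infinite runs from $(q,x)$, and a run satisfies $\varphi\,\mathbf U_{\mathrm{cost}_i\sim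 c}\,\psi$ if, for some position $\pi>0$ (positions being counted in mixed moves), the configuration at $\pi$ satisfies $\psi$, the configurations at all positions $0<\pi'<\pi$ satisfy $\varphi$, and the accumulated $i$-th cost up to $\pi$ is $\sim c$. A modality is constrained unless its constraint is the trivial one $\ge 0$ or $>0$. Proposition. Let $\Phi$ be a WCTL formula and $\mathcal A$ a one-clock labeled priced timed automaton (which need not be non-blocking). Let $C$ be the least common multiple of all positive cost rates of locations of $\mathcal A$ ($C=1$ if there are none), let $h(\Phi)$ be the maximal number of nested constrained modalities in $\Phi$, and let $M$ be the largest constant appearing in the clock constraints (guards and invariants) of $\mathcal A$. Then there are constants $0=a_0<a_1<\dots<a_n<a_{n+1}=+\infty$ such that 1. for every location $q$ and every $0\le i\le n$, the truth of $\Phi$ is constant on $\{(q,x)\mid a_i<x<a_{i+1}\}$; 2. $\{a_0,\dots,a_n\}$ contains all the constants appearing in the clock constraints of $\mathcal A$; 3. $a_0,\dots,a_n$ are integral multiples of $1/C^{h(\Phi)}$; 4. $a_n=M$. In particular, $n\le M\cdot C^{h(\Phi)}+1$. -/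

import Mathlib

open scoped NNReal

namespace PricedTimed

/-- Comparison operators `<, ≤, =, ≥, >`. -/
inductive Cmp where
  | lt | le | eq | ge | gt

/-- `r.Holds a b` means `a ∼ b`, where `∼` is the operator named by `r`. -/
def Cmp.Holds : Cmp → ℝ≥0 → ℝ≥0 → Prop
  | .lt, a, b => a < b
  | .le, a, b => a ≤ b
  | .eq, a, b => a = b
  | .ge, a, b => b ≤ a
  | .gt, a, b => b < a

/-- Clock constraints (guards) over the clocks `X`: `g ::= x ∼ c | g ∧ g`, with `c ∈ ℕ`. -/
inductive Guard (X : Type*) where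
  | atom (x : X) (r : Cmp) (c : ℕ)
  | and (g₁ g₂ : Guard X)

/-- Clock valuations. -/
abbrev Valuation (X : Type*) := X → ℝ≥0

/-- The valuation `v + t`. -/
def Valuation.delay {X : Type*} (v : Valuation X) (t : ℝ≥0) : Valuation X := fun x => v x + t

/-- The valuation `[R ← 0]v`: zero on `R`, equal to `v` outside `R`. -/
noncomputable def Valuation.reset {X : Type*} (R : Set X) (v : Valuation X) : Valuation X :=
  Set.indicator Rᶜ v

/-- `g.Holds v` means `v ⊨ g`. -/
def Guard.Holds {X : Type*} : Guard X → Valuation X → Prop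
  | .atom x r c, v => r.Holds (v x) c
  | .and g₁ g₂, v => g₁.Holds v ∧ g₂.Holds v

/-- The constants occurring in a clock constraint. -/
def Guard.consts {X : Type*} : Guard X → Finset ℕ
  | .atom _ _ c => {c}
  | .and g₁ g₂ => g₁.consts ∪ g₂.consts

/-- Tuples `(q, g, R, q')` in `Loc × Constr(X) × 2^X × Loc`. -/
structure Edge (X Loc : Type*) where
  src : Loc
  guard : Guard X
  resets : Set X
  tgt : Loc

/-- Priced timed automata with clocks `X`, locations `Loc` and `p` cost functions.
Only the values of `edgeCost i` on elements of `edges` are relevant. -/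
structure PTA (X Loc : Type*) (p : ℕ) where
  init : Loc
  edges : Finset (Edge X Loc)
  inv : Loc → Guard X
  locCost : Fin p → Loc → ℕ
  edgeCost : Fin p → Edge X Loc → ℕ

/-- Priced timed automata with a labeling of the locations by sets of atomic propositions. -/
structure LabeledPTA (AP X Loc : Type*) (p : ℕ) extends PTA X Loc p where
  lab : Loc → Set AP

/-- Configurations `(q, v)`. -/
abbrev State (X Loc : Type*) := Loc × Valuation X

namespace PTA

variable {X Loc : Type*} {p : ℕ} (A : PTA X Loc p)

/-- The delay move from `s` to `s'` of duration `t`. -/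
def DelayMove (s : State X Loc) (t : ℝ≥0) (s' : State X Loc) : Prop :=
  (∀ t' ≤ t, (A.inv s.1).Holds (s.2.delay t')) ∧ s' = (s.1, s.2.delay t)

/-- The discrete move from `s` to `s'` along the transition `e`. -/
def DiscreteMove (s : State X Loc) (e : Edge X Loc) (s' : State X Loc) : Prop :=
  e ∈ A.edges ∧ e.src = s.1 ∧ e.guard.Holds s.2 ∧
    s' = (e.tgt, s.2.reset e.resets) ∧ (A.inv s'.1).Holds s'.2

/-- The mixed move from `s` to `s'`: a delay `t` followed by the transition `e`. -/
def MixedMove (s : State X Loc) (t : ℝ≥0) (e : Edge X Loc) (s' : State X Loc) : Prop :=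
  ∃ s₁, A.DelayMove s t s₁ ∧ A.DiscreteMove s₁ e s'

/-- Infinite runs: infinite sequences of mixed moves. -/
structure Run where
  state : ℕ → State X Loc
  dly : ℕ → ℝ≥0
  edge : ℕ → Edge X Loc
  step : ∀ k, A.MixedMove (state k) (dly k) (edge k) (state (k + 1))

/-- The `i`-th cost of the finite prefix of `ρ` that ends at position `π`. -/
noncomputable def Run.prefixCost {A : PTA X Loc p} (ρ : A.Run) (i : Fin p) (π : ℕ) : ℝ≥0 :=
  ∑ k ∈ Finset.range π,
    (ρ.dly k * (A.locCost i (ρ.state k).1 : ℝ≥0) + (A.edgeCost i (ρ.edge k) : ℝ≥0))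

/-- `ρ ⊨ S U_{cost_i ∼ c} T`, where `S` and `T` are predicates on configurations. -/
def Run.Until {A : PTA X Loc p} (ρ : A.Run) (S : State X Loc → Prop) (i : Fin p) (r : Cmp)
    (c : ℕ) (T : State X Loc → Prop) : Prop :=
  ∃ π, 0 < π ∧ T (ρ.state π) ∧ (∀ π', 0 < π' → π' < π → S (ρ.state π')) ∧
    r.Holds (ρ.prefixCost i π) c

variable [Fintype Loc]

/-- The constants occurring in the clock constraints (on transitions and in invariants). -/
def consts : Finset ℕ :=
  (A.edges.biUnion fun e => e.guard.consts) ∪ (Finset.univ.biUnion fun q => (A.inv q).consts)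

/-- The largest constant occurring in the clock constraints. -/
def maxConst : ℕ := A.consts.sup id

/-- The lcm of all positive costs labeling a location (`1` if there is none). -/
def rateLcm : ℕ :=
  ((Finset.univ : Finset (Fin p × Loc)).filter fun iq => 0 < A.locCost iq.1 iq.2).lcm
    fun iq => A.locCost iq.1 iq.2

end PTA

/-- WCTL formulas over the atomic propositions `AP` and `p` cost functions. -/
inductive Formula (AP : Type*) (p : ℕ) where
  | atom (a : AP)
  | neg (φ : Formula AP p)
  | or (φ ψ : Formula AP p)
  /-- `E φ U_{cost_i ∼ c} ψ` -/
  | EU (φ : Formula AP p) (i : Fin p) (r : Cmp) (c : ℕ) (ψ : Formula AP p)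
  /-- `A φ U_{cost_i ∼ c} ψ` -/
  | AU (φ : Formula AP p) (i : Fin p) (r : Cmp) (c : ℕ) (ψ : Formula AP p)

/-- The contribution of a modality with constraint `∼ c` to the height: `0` for the trivial
constraints `≥ 0` and `> 0` (no constraining interval other than `(0, ∞)`), `1` otherwise. -/
def Cmp.weight : Cmp → ℕ → ℕ
  | .ge, 0 => 0
  | .gt, 0 => 0
  | _, _ => 1

/-- The constrained temporal height: the maximal number of nested constrained modalities. -/
def Formula.height {AP : Type*} {p : ℕ} : Formula AP p → ℕ
  | .atom _ => 0
  | .neg φ => φ.height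
  | .or φ ψ => max φ.height ψ.height
  | .EU φ _ r c ψ => max φ.height ψ.height + r.weight c
  | .AU φ _ r c ψ => max φ.height ψ.height + r.weight c

/-- The satisfaction relation `(q, v) ⊨ φ` of WCTL. -/
def LabeledPTA.Sat {AP X Loc : Type*} {p : ℕ} (A : LabeledPTA AP X Loc p) :
    Formula AP p → State X Loc → Prop
  | .atom a, s => a ∈ A.lab s.1
  | .neg φ, s => ¬ A.Sat φ s
  | .or φ ψ, s => A.Sat φ s ∨ A.Sat ψ s
  | .EU φ i r c ψ, s =>
      ∃ ρ : A.toPTA.Run, ρ.state 0 = s ∧ ρ.Until (fun s' => A.Sat φ s') i r c (fun s' => A.Sat ψ s')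
  | .AU φ i r c ψ, s =>
      ∀ ρ : A.toPTA.Run, ρ.state 0 = s → ρ.Until (fun s' => A.Sat φ s') i r c (fun s' => A.Sat ψ s')

end PricedTimed

/-!
The breakpoints are all multiples of `1 / C ^ h` up to `M`, where `C = A.rateLcm`, `h = Φ.height`
and `M = A.maxConst`. What has to be shown is that the truth of `Φ` is constant between
consecutive multiples and above `M` (`LabeledPTA.regionInvariant_sat`), by induction on `Φ`.

An infinite run is described by its transitions and by the clock values before them
(`PTA.IsTrajectory`). Suppose that the arguments `S`, `T` of a modality are invariant on the
regions of granularity `1 / N` (points `k / N` and open intervals between them). Fix the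
transitions of a run and the regions of the clock values before them. Every choice of clock values
(a timing) in these regions gives a run again, with the same truth values of `S` and `T` at all
positions. The timings form a convex set, on which the cost up to a position is a linear function.

The central fact is `hasProfile_timingCost`. With `1 / N` as unit of time, the infimum over all
timings of the cost up to position `n` is `ρ * (⌈x⌉ - x) + a`, where `x` is the initial clock
value in a fixed region, `ρ` is `0` or a rate, and `a` is an integer; whether the infimum is
attained does not depend on `x`. As `ρ`, if not `0`, divides `C`, comparing this infimum with an
integer gives the same answer throughout a region of granularity `1 / C`. Negating all rates gives the same for
suprema. By convexity, the equality `cost = c` and the conjunction `cost_m < c < cost_n` reduce to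
such comparisons (`PTA.exists_follows_holds`, `PTA.exists_follows_lt_lt`). This settles the
existential modality.

For the universal one, consider a run that violates the until modality, and the positions where it
holds apart from the cost constraint. As the cost is monotone, the constraint is violated at all
of them as soon as it is violated at the first one, at the last one, or at two consecutive ones
(`PTA.exists_forall_not_holds`). The remaining case is that there are infinitely many such
positions and the cost of the whole infinite run is bounded by `c`. If the clock is reset
infinitely often, some location is entered infinitely often with clock value `0`, and the run may
be continued from there by one of its own tails of arbitrarily small cost; otherwise the clock
finally stays in one region or above `M`, and delays may be dropped; and if the bound `c` is
attained, the rest of the run is free (`PTA.exists_forall_cost_lt`, `PTA.exists_forall_cost_le`).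

The constraints `≥ 0` and `> 0` need no refinement of the granularity: an increasing map of one
region to itself transfers timings so that the same moves have positive cost. Above `M`, runs may
be shifted in time until the first reset.
-/

namespace PricedTimed

/-! ### Regions of the half-line -/

/-- The region of a clock value with respect to the integers: `2 * k` encodes the point `k`, and
`2 * k + 1` the open interval `(k, k + 1)`. Finer regions are regions of multiples of the value. -/
noncomputable def regionCode (x : ℝ) : ℕ := ⌊x⌋₊ + ⌈x⌉₊

lemma regionCode_mono : Monotone regionCode := fun _ _ h =>
  add_le_add (Nat.floor_mono h) (Nat.ceil_mono h)

lemma regionCode_lt_iff {x : ℝ} (hx : 0 ≤ x) {m : ℕ} : regionCode x < 2 * m ↔ x < m := by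
  unfold regionCode
  constructor
  · intro h
    by_contra! hm
    have h1 := Nat.le_floor hm
    have h2 : m ≤ ⌈x⌉₊ := by exact_mod_cast hm.trans (Nat.le_ceil x)
    omega
  · intro h
    have h1 := (Nat.floor_lt hx).2 h
    have h2 := Nat.ceil_le.2 h.le
    omega

lemma lt_regionCode_iff {x : ℝ} {m : ℕ} : 2 * m < regionCode x ↔ (m : ℝ) < x := by
  unfold regionCode
  constructor
  · intro h
    by_contra! hm
    have h1 := Nat.ceil_le.2 hm
    have h2 := Nat.floor_le_ceil x
    omega
  · intro h
    have h1 := Nat.lt_ceil.2 h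
    have h2 := Nat.le_floor h.le
    omega

lemma regionCode_eq_even {x : ℝ} (hx : 0 ≤ x) {k : ℕ} : regionCode x = 2 * k ↔ x = k := by
  have h1 := regionCode_lt_iff hx (m := k)
  have h2 := lt_regionCode_iff (x := x) (m := k)
  constructor
  · intro h
    rw [h] at h1 h2
    exact le_antisymm (not_lt.1 (h2.not.1 (lt_irrefl _))) (not_lt.1 (h1.not.1 (lt_irrefl _)))
  · intro h
    have h3 := h1.not.2 h.not_lt
    have h4 := h2.not.2 h.symm.not_lt
    omega

lemma regionCode_eq_odd {x : ℝ} (hx : 0 ≤ x) {k : ℕ} :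
    regionCode x = 2 * k + 1 ↔ (k : ℝ) < x ∧ x < k + 1 := by
  have h1 := regionCode_lt_iff hx (m := k + 1)
  have h2 := lt_regionCode_iff (x := x) (m := k)
  push_cast at h1
  rw [← h1, ← h2]
  omega

lemma regionCode_eq_iff {x x' : ℝ} (hx : 0 ≤ x) (hx' : 0 ≤ x') :
    regionCode x = regionCode x' ↔ ∀ m : ℕ, (x < m ↔ x' < m) ∧ ((m : ℝ) < x ↔ (m : ℝ) < x') := by
  constructor
  · intro h m
    rw [← regionCode_lt_iff hx, ← regionCode_lt_iff hx', ← lt_regionCode_iff,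
      ← lt_regionCode_iff, h]
    exact ⟨Iff.rfl, Iff.rfl⟩
  · intro h
    have h1 : ⌊x⌋₊ = ⌊x'⌋₊ := eq_of_forall_le_iff fun m => by
      rw [Nat.le_floor_iff hx, Nat.le_floor_iff hx', ← not_lt, ← not_lt, (h m).1]
    have h2 : ⌈x⌉₊ = ⌈x'⌉₊ := eq_of_forall_ge_iff fun m => by
      rw [Nat.ceil_le, Nat.ceil_le, ← not_lt, ← not_lt, (h m).2]
    rw [regionCode, regionCode, h1, h2]

lemma regionCode_of_mul {x x' : ℝ} (hx : 0 ≤ x) (hx' : 0 ≤ x') {a : ℕ} (ha : 0 < a)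
    (h : regionCode (a * x) = regionCode (a * x')) : regionCode x = regionCode x' := by
  have ha' : (0 : ℝ) < a := by exact_mod_cast ha
  rw [regionCode_eq_iff (by positivity) (by positivity)] at h
  rw [regionCode_eq_iff hx hx']
  intro m
  have h1 := h (a * m)
  push_cast at h1
  rwa [mul_lt_mul_iff_right₀ ha', mul_lt_mul_iff_right₀ ha', mul_lt_mul_iff_right₀ ha',
    mul_lt_mul_iff_right₀ ha'] at h1

lemma ceil_eq_of_regionCode_even {x : ℝ} (hx : 0 ≤ x) {k : ℕ} (h : regionCode x = 2 * k) :
    (⌈x⌉₊ : ℝ) = k := by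
  rw [(regionCode_eq_even hx).1 h, Nat.ceil_natCast]

lemma ceil_eq_of_regionCode_odd {x : ℝ} (hx : 0 ≤ x) {k : ℕ} (h : regionCode x = 2 * k + 1) :
    (⌈x⌉₊ : ℝ) = k + 1 := by
  obtain ⟨h1, h2⟩ := (regionCode_eq_odd hx).1 h
  have : ⌈x⌉₊ = k + 1 :=
    (Nat.ceil_eq_iff (by omega)).2 ⟨by simpa using h1, by push_cast; exact h2.le⟩
  rw [this]; push_cast; rfl

/-! ### Optimal cost as a function of the clock -/

/-- `F x` is, for `x` in the region `j`, the ray `[f x, ∞)` or the ray `(f x, ∞)`, where `f` is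
affine with integer value at the right end point of the region and slope the negative of an element
of `Q`. Here `F x u` is read as `u` lying in the ray at `x`; the proposition `b` says that the ray
is closed. -/
def HasProfile (Q : Set ℤ) (j : ℕ) (F : ℝ → ℝ → Prop) : Prop :=
  ∃ ρ ∈ Q, ∃ a : ℤ, ∃ b : Prop, ∀ x, 0 ≤ x → regionCode x = j → ∀ u,
    F x u ↔ ((ρ : ℝ) * (⌈x⌉₊ - x) + a < u ∨ b ∧ (ρ : ℝ) * (⌈x⌉₊ - x) + a = u)

variable {Q : Set ℤ} {F : ℝ → ℝ → Prop} {j : ℕ}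

lemma HasProfile.congr {G : ℝ → ℝ → Prop} (hF : HasProfile Q j F)
    (h : ∀ x, 0 ≤ x → regionCode x = j → ∀ u, G x u ↔ F x u) : HasProfile Q j G := by
  obtain ⟨ρ, hρ, a, b, H⟩ := hF
  exact ⟨ρ, hρ, a, b, fun x hx hj u => (h x hx hj u).trans (H x hx hj u)⟩

lemma HasProfile.zero (h0 : (0 : ℤ) ∈ Q) : HasProfile Q j fun _ u => 0 ≤ u :=
  ⟨0, h0, 0, True, fun x _ _ u => by simp [le_iff_lt_or_eq]⟩

lemma HasProfile.sub_const (hF : HasProfile Q j F) (d : ℤ) :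
    HasProfile Q j fun x u => F x (u - d) := by
  obtain ⟨ρ, hρ, a, b, H⟩ := hF
  refine ⟨ρ, hρ, a + d, b, fun x hx hj u => ?_⟩
  beta_reduce
  rw [H x hx hj, lt_sub_iff_add_lt, eq_sub_iff_add_eq]
  push_cast
  rw [add_assoc]

lemma HasProfile.reset (h0 : (0 : ℤ) ∈ Q) (hF : HasProfile Q 0 F) (j : ℕ) :
    HasProfile Q j fun _ u => F 0 u := by
  obtain ⟨ρ, hρ, a, b, H⟩ := hF
  refine ⟨0, h0, a, b, fun x hx hj u => ?_⟩
  beta_reduce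
  rw [H 0 le_rfl (by simp [regionCode])]
  simp

/-- The infimum of an increasing linear function over an open interval `(0, l)`, which is not
attained. -/
lemma exists_pos_mul_lt {s l v : ℝ} (hs : 0 < s) (hl : 0 < l) :
    (∃ t, 0 < t ∧ t < l ∧ s * t < v) ↔ 0 < v := by
  constructor
  · rintro ⟨t, ht, -, h⟩
    exact (mul_pos hs ht).trans h
  · intro hv
    have h1 : 0 < v / s := by positivity
    refine ⟨min l (v / s) / 2, by positivity, ?_, ?_⟩
    · linarith [min_le_left l (v / s)]
    · have h2 : s * min l (v / s) ≤ v := by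
        calc s * min l (v / s) ≤ s * (v / s) := by gcongr; exact min_le_right _ _
          _ = v := by field_simp
      linarith

lemma HasProfile.next (hF : HasProfile Q (j + 1) F) {r : ℤ} (hr : r ∈ Q) :
    HasProfile Q j fun x u => ∃ z, 0 ≤ z ∧ regionCode z = j + 1 ∧ F z (u - r * (z - x)) := by
  obtain ⟨ρ, hρ, a, b, H⟩ := hF
  obtain ⟨k, rfl | rfl⟩ := j.even_or_odd'
  · have key : ∀ x, 0 ≤ x → regionCode x = 2 * k → ∀ u,
        (∃ z, 0 ≤ z ∧ regionCode z = 2 * k + 1 ∧ F z (u - r * (z - x))) ↔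
        ∃ t : ℝ, 0 < t ∧ t < 1 ∧ (ρ + a + (r - ρ) * t < u ∨ b ∧ ρ + a + (r - ρ) * t = u) := by
      intro x hx hj u
      have hxk := (regionCode_eq_even hx).1 hj
      have e : ∀ z, 0 ≤ z → regionCode z = 2 * k + 1 → (F z (u - r * (z - x)) ↔
          (ρ + a + (r - ρ) * (z - k) < u ∨ b ∧ ρ + a + (r - ρ) * (z - k) = u)) := by
        intro z hz hj'
        rw [H z hz hj', ceil_eq_of_regionCode_odd hz hj', lt_sub_iff_add_lt, eq_sub_iff_add_eq,
          hxk]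
        ring_nf
      constructor
      · rintro ⟨z, hz, hj', h⟩
        obtain ⟨h1, h2⟩ := (regionCode_eq_odd hz).1 hj'
        exact ⟨z - k, by linarith, by linarith, (e z hz hj').1 h⟩
      · rintro ⟨t, h0, h1, h⟩
        have hz : (0 : ℝ) ≤ k + t := by positivity
        have hj' := (regionCode_eq_odd (k := k) hz).2 ⟨by linarith, by linarith⟩
        exact ⟨k + t, hz, hj', (e _ hz hj').2 (by simpa using h)⟩
    have hc : ∀ x, 0 ≤ x → regionCode x = 2 * k → (⌈x⌉₊ : ℝ) - x = 0 := fun x hx hj => by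
      rw [ceil_eq_of_regionCode_even hx hj, (regionCode_eq_even hx).1 hj, sub_self]
    rcases lt_trichotomy r ρ with h | h | h
    · have h' : (0 : ℝ) < ρ - r := by rw [sub_pos]; exact_mod_cast h
      refine ⟨ρ, hρ, r + a, False, fun x hx hj u => ?_⟩
      beta_reduce
      rw [key x hx hj, hc x hx hj]
      have h1 := exists_pos_mul_lt (v := u - (r + a)) h' one_pos
      push_cast
      simp only [mul_zero, zero_add, false_and, or_false]
      rw [← sub_pos, ← h1]
      constructor
      · rintro ⟨t, t0, t1, h2⟩
        by_cases hb : ρ + a + (r - ρ) * t < u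
        · exact ⟨1 - t, by linarith, by linarith, by linarith⟩
        · obtain ⟨-, h2⟩ := h2.resolve_left hb
          refine ⟨(1 - t) / 2, by linarith, by linarith, ?_⟩
          nlinarith [mul_pos h' (sub_pos.2 t1)]
      · rintro ⟨t, t0, t1, h2⟩
        exact ⟨1 - t, by linarith, by linarith, Or.inl (by linarith)⟩
    · subst h
      refine ⟨r, hρ, r + a, b, fun x hx hj u => ?_⟩
      beta_reduce
      rw [key x hx hj, hc x hx hj]
      simp only [sub_self, zero_mul, add_zero, mul_zero, zero_add]
      push_cast
      exact ⟨fun ⟨_, _, _, h⟩ => h, fun h => ⟨1 / 2, by norm_num, by norm_num, h⟩⟩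
    · have h' : (0 : ℝ) < r - ρ := by rw [sub_pos]; exact_mod_cast h
      refine ⟨ρ, hρ, ρ + a, False, fun x hx hj u => ?_⟩
      beta_reduce
      rw [key x hx hj, hc x hx hj]
      have h1 := exists_pos_mul_lt (v := u - (ρ + a)) h' one_pos
      push_cast
      simp only [mul_zero, zero_add, false_and, or_false]
      rw [← sub_pos, ← h1]
      constructor
      · rintro ⟨t, t0, t1, h2⟩
        by_cases hb : ρ + a + (r - ρ) * t < u
        · exact ⟨t, by linarith, by linarith, by linarith⟩
        · obtain ⟨-, h2⟩ := h2.resolve_left hb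
          refine ⟨t / 2, by linarith, by linarith, ?_⟩
          nlinarith [mul_pos h' t0]
      · rintro ⟨t, t0, t1, h2⟩
        exact ⟨t, by linarith, by linarith, Or.inl (by linarith)⟩
  · refine ⟨r, hr, a, b, fun x hx hj u => ?_⟩
    have e : 2 * k + 1 + 1 = 2 * (k + 1) := by ring
    have hz : (0 : ℝ) ≤ (k + 1 : ℕ) := by positivity
    have hj' := (regionCode_eq_even (k := k + 1) hz).2 rfl
    rw [e] at H ⊢
    have h1 : (∃ z, 0 ≤ z ∧ regionCode z = 2 * (k + 1) ∧ F z (u - r * (z - x))) ↔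
        F (k + 1 : ℕ) (u - r * ((k + 1 : ℕ) - x)) := by
      constructor
      · rintro ⟨z, h0, h2, h3⟩
        rwa [(regionCode_eq_even h0).1 h2] at h3
      · exact fun h => ⟨_, hz, hj', h⟩
    beta_reduce
    rw [h1, H _ hz hj', ceil_eq_of_regionCode_even hz hj', ceil_eq_of_regionCode_odd hx hj,
      lt_sub_iff_add_lt, eq_sub_iff_add_eq]
    push_cast
    ring_nf

lemma HasProfile.wait (hF : HasProfile Q j F) {r : ℤ} (hr : r ∈ Q) :
    HasProfile Q j fun x u => ∃ z, x ≤ z ∧ regionCode z = j ∧ F z (u - r * (z - x)) := by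
  obtain ⟨ρ, hρ, a, b, H⟩ := hF
  obtain ⟨k, rfl | rfl⟩ := j.even_or_odd'
  · refine ⟨ρ, hρ, a, b, fun x hx hj u => ?_⟩
    rw [← H x hx hj]
    constructor
    · rintro ⟨z, h0, h1, h2⟩
      have : z = x := by
        rw [(regionCode_eq_even (hx.trans h0)).1 h1, (regionCode_eq_even hx).1 hj]
      subst this
      simpa using h2
    · exact fun h => ⟨x, le_rfl, hj, by simpa using h⟩
  · have e : ∀ x, 0 ≤ x → ∀ u z, x ≤ z → regionCode z = 2 * k + 1 → (F z (u - r * (z - x)) ↔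
        (ρ * (k + 1 - x) + a + (r - ρ) * (z - x) < u ∨
          b ∧ ρ * (k + 1 - x) + a + (r - ρ) * (z - x) = u)) := by
      intro x hx u z hz hj'
      rw [H z (hx.trans hz) hj', ceil_eq_of_regionCode_odd (hx.trans hz) hj', lt_sub_iff_add_lt,
        eq_sub_iff_add_eq]
      ring_nf
    rcases lt_or_ge r ρ with h | h
    · have h' : (0 : ℝ) < ρ - r := by rw [sub_pos]; exact_mod_cast h
      refine ⟨r, hr, a, False, fun x hx hj u => ?_⟩
      rw [ceil_eq_of_regionCode_odd hx hj]
      obtain ⟨hk, hk'⟩ := (regionCode_eq_odd hx).1 hj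
      have h1 := exists_pos_mul_lt (l := k + 1 - x) (v := u - (r * (k + 1 - x) + a)) h'
        (by linarith)
      simp only [false_and, or_false]
      rw [← sub_pos, ← h1]
      constructor
      · rintro ⟨z, hz, hj', h2⟩
        rw [e x hx u z hz hj'] at h2
        obtain ⟨hz1, hz2⟩ := (regionCode_eq_odd (hx.trans hz)).1 hj'
        have h3 : ρ * (k + 1 - x) + a + (r - ρ) * (z - x) ≤ u := by
          rcases h2 with h2 | ⟨-, h2⟩
          exacts [h2.le, h2.le]
        refine ⟨(k + 1 - z) / 2, by linarith, by linarith, ?_⟩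
        nlinarith [mul_pos h' (sub_pos.2 hz2)]
      · rintro ⟨t, t0, t1, h2⟩
        have hj' := (regionCode_eq_odd (x := k + 1 - t) (k := k) (by linarith)).2
          ⟨by linarith, by linarith⟩
        exact ⟨k + 1 - t, by linarith, hj', (e x hx u _ (by linarith) hj').2
          (Or.inl (by linarith))⟩
    · have h' : (0 : ℝ) ≤ r - ρ := by rw [sub_nonneg]; exact_mod_cast h
      refine ⟨ρ, hρ, a, b, fun x hx hj u => ?_⟩
      rw [ceil_eq_of_regionCode_odd hx hj]
      constructor
      · rintro ⟨z, hz, hj', h2⟩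
        rw [e x hx u z hz hj'] at h2
        have h3 := mul_nonneg h' (sub_nonneg.2 hz)
        rcases h2 with h2 | ⟨hb, h2⟩
        · exact Or.inl (by linarith)
        · rcases (show ρ * (k + 1 - x) + a ≤ u by linarith).lt_or_eq with h4 | h4
          exacts [Or.inl h4, Or.inr ⟨hb, h4⟩]
      · exact fun h => ⟨x, le_rfl, hj, (e x hx u x le_rfl hj).2 (by simpa using h)⟩

/-- A delay is a waiting period within one region, or a sequence of passages to the next region. -/
lemma HasProfile.delay {j₁ : ℕ} (hF : HasProfile Q j₁ F) {r : ℤ} (hr : r ∈ Q) (hj : j ≤ j₁) :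
    HasProfile Q j fun x u => ∃ z, x ≤ z ∧ regionCode z = j₁ ∧ F z (u - r * (z - x)) := by
  induction hj using Nat.decreasingInduction with
  | self => exact hF.wait hr
  | of_succ i hi ih =>
    refine (ih.next hr).congr fun x hx hxi u => ⟨?_, ?_⟩
    · rintro ⟨z, hz, hzj, h⟩
      have hz0 := hx.trans hz
      obtain ⟨w, hw0, hwz, hw⟩ : ∃ w, 0 ≤ w ∧ w ≤ z ∧ regionCode w = i + 1 := by
        rcases (Nat.succ_le_of_lt hi).lt_or_eq with h1 | h1
        · obtain ⟨k, rfl | rfl⟩ := i.even_or_odd'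
          · refine ⟨k + 1 / 2, by positivity, ?_, ?_⟩
            · have h2 : ¬ regionCode z < 2 * (k + 1) := by omega
              rw [regionCode_lt_iff hz0] at h2
              push_cast at h2
              linarith
            · exact (regionCode_eq_odd (by positivity)).2 ⟨by linarith, by linarith⟩
          · refine ⟨(k + 1 : ℕ), by positivity, ?_, ?_⟩
            · have h2 : 2 * (k + 1) < regionCode z := by omega
              exact ((lt_regionCode_iff).1 h2).le
            · exact (regionCode_eq_even (k := k + 1) (by positivity)).2 rfl
        · exact ⟨z, hz0, le_rfl, hzj.trans h1.symm⟩
      refine ⟨w, hw0, hw, z, hwz, hzj, ?_⟩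
      convert h using 1
      ring
    · rintro ⟨w, hw0, hw, z, hwz, hzj, h⟩
      refine ⟨z, ?_, hzj, ?_⟩
      · by_contra! hlt
        have := regionCode_mono hlt.le
        have := regionCode_mono hwz
        omega
      · convert h using 1
        ring

end PricedTimed

namespace PricedTimed

/-! ### Timings along a fixed sequence of regions and resets -/

/-- The clock value before the `k`-th delay, if it is `x` initially and `y k` after the `k`-th
delay, and if `R k` tells whether it is reset after the `k`-th delay. -/
noncomputable def clockBefore (x : ℝ) (R : ℕ → Prop) (y : ℕ → ℝ) : ℕ → ℝ
  | 0 => x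
  | k + 1 => open Classical in if R k then 0 else y k

/-- The sequences of clock values after the delays, for the initial value `x` and the resets `R`,
that visit the regions `j`. -/
def timings (R : ℕ → Prop) (j : ℕ → ℕ) (x : ℝ) : Set (ℕ → ℝ) :=
  {y | ∀ k, clockBefore x R y k ≤ y k ∧ regionCode (y k) = j k}

/-- The cost of the first `n` moves for the rates `r` and the discrete costs `d`. -/
noncomputable def timingCost (r d : ℕ → ℤ) (x : ℝ) (R : ℕ → Prop) (y : ℕ → ℝ) (n : ℕ) : ℝ :=
  ∑ k ∈ Finset.range n, ((r k : ℝ) * (y k - clockBefore x R y k) + d k)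

variable {x x' : ℝ} {R : ℕ → Prop} {y y' : ℕ → ℝ} {j : ℕ → ℕ} {r d : ℕ → ℤ} {k n : ℕ}

@[simp] lemma clockBefore_zero : clockBefore x R y 0 = x := rfl

lemma clockBefore_succ_of_reset (h : R k) : clockBefore x R y (k + 1) = 0 := if_pos h

lemma clockBefore_succ_of_not (h : ¬ R k) : clockBefore x R y (k + 1) = y k := if_neg h

lemma clockBefore_add (x : ℝ) (R : ℕ → Prop) (y : ℕ → ℝ) (n k : ℕ) :
    clockBefore x R y (n + k) =
      clockBefore (clockBefore x R y n) (fun i => R (n + i)) (fun i => y (n + i)) k := by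
  cases k <;> rfl

lemma clockBefore_cons (x : ℝ) (R : ℕ → Prop) (y : ℕ → ℝ) (k : ℕ) :
    clockBefore x R y (k + 1) =
      clockBefore (clockBefore x R y 1) (fun i => R (i + 1)) (fun i => y (i + 1)) k := by
  cases k <;> rfl

lemma clockBefore_congr {R' : ℕ → Prop} (h : ∀ i < k, (R i ↔ R' i) ∧ y i = y' i) :
    clockBefore x R y k = clockBefore x R' y' k := by
  cases k with
  | zero => rfl
  | succ k =>
    obtain ⟨h1, h2⟩ := h k k.lt_succ_self
    by_cases hk : R k
    · rw [clockBefore_succ_of_reset hk, clockBefore_succ_of_reset (h1.1 hk)]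
    · rw [clockBefore_succ_of_not hk, clockBefore_succ_of_not (h1.not.1 hk), h2]

lemma clockBefore_nonneg (hx : 0 ≤ x) (h : ∀ k, clockBefore x R y k ≤ y k) (k : ℕ) :
    0 ≤ clockBefore x R y k := by
  induction k with
  | zero => exact hx
  | succ k ih =>
    by_cases hk : R k
    · rw [clockBefore_succ_of_reset hk]
    · rw [clockBefore_succ_of_not hk]
      exact ih.trans (h k)

lemma clockBefore_mul (a x : ℝ) (R : ℕ → Prop) (y : ℕ → ℝ) (k : ℕ) :
    clockBefore (a * x) R (fun i => a * y i) k = a * clockBefore x R y k := by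
  cases k with
  | zero => rfl
  | succ k => simp only [clockBefore]; split_ifs <;> simp

lemma clockBefore_comb (s t x : ℝ) (hst : s + t = 1) (R : ℕ → Prop) (y y' : ℕ → ℝ) (k : ℕ) :
    clockBefore x R (fun i => s * y i + t * y' i) k =
      s * clockBefore x R y k + t * clockBefore x R y' k := by
  cases k with
  | zero => rw [clockBefore_zero, clockBefore_zero, clockBefore_zero, ← add_mul, hst, one_mul]
  | succ k => simp only [clockBefore]; split_ifs <;> simp

lemma regionCode_clockBefore (h : regionCode x = regionCode x')
    (hy : ∀ k, regionCode (y k) = regionCode (y' k)) (k : ℕ) :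
    regionCode (clockBefore x R y k) = regionCode (clockBefore x' R y' k) := by
  cases k with
  | zero => exact h
  | succ k => simp only [clockBefore]; split_ifs <;> simp [hy]

lemma le_clockBefore (h : ∀ k, clockBefore x R y k ≤ y k) (k : ℕ) (hk : ¬ ∃ i < k, R i) :
    x ≤ clockBefore x R y k := by
  induction k with
  | zero => exact le_rfl
  | succ k ih =>
    rw [clockBefore_succ_of_not fun hR => hk ⟨k, k.lt_succ_self, hR⟩]
    exact (ih fun ⟨i, hi, hR⟩ => hk ⟨i, hi.trans k.lt_succ_self, hR⟩).trans (h k)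

open Classical in
/-- Apply `f` to the clock values before the first reset. -/
noncomputable def retime (f : ℝ → ℝ) (R : ℕ → Prop) (y : ℕ → ℝ) (k : ℕ) : ℝ :=
  if ∃ i < k, R i then y k else f (y k)

lemma retime_cases (f : ℝ → ℝ) (h : ∀ k, clockBefore x R y k ≤ y k) (k : ℕ) :
    (clockBefore (f x) R (retime f R y) k = clockBefore x R y k ∧ retime f R y k = y k) ∨
    (x ≤ clockBefore x R y k ∧
      clockBefore (f x) R (retime f R y) k = f (clockBefore x R y k) ∧
      retime f R y k = f (y k)) := by
  have key : clockBefore (f x) R (retime f R y) k =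
      open Classical in if ∃ i < k, R i then clockBefore x R y k else f (clockBefore x R y k) := by
    cases k with
    | zero => simp
    | succ k =>
      by_cases hk : R k
      · rw [clockBefore_succ_of_reset hk, clockBefore_succ_of_reset hk,
          if_pos ⟨k, k.lt_succ_self, hk⟩]
      · rw [clockBefore_succ_of_not hk, clockBefore_succ_of_not hk, retime]
        have : (∃ i < k, R i) ↔ ∃ i < k + 1, R i :=
          ⟨fun ⟨i, hi, h⟩ => ⟨i, by omega, h⟩, fun ⟨i, hi, h⟩ =>
            ⟨i, lt_of_le_of_ne (by omega) (by rintro rfl; exact hk h), h⟩⟩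
        by_cases hp : ∃ i < k, R i
        · rw [if_pos hp, if_pos (this.1 hp)]
        · rw [if_neg hp, if_neg (this.not.1 hp)]
  by_cases hk : ∃ i < k, R i
  · left
    rw [key, retime, if_pos hk, if_pos hk]
    exact ⟨rfl, rfl⟩
  · right
    rw [key, retime, if_neg hk, if_neg hk]
    exact ⟨le_clockBefore h k hk, rfl, rfl⟩

/-- Two points of a region are related by an increasing map that preserves the regions of all
later points. -/
lemma exists_strictMono_regionCode (hx : 0 ≤ x) (hx' : 0 ≤ x') (h : regionCode x = regionCode x') :
    ∃ f : ℝ → ℝ, StrictMono f ∧ f x = x' ∧ ∀ z, x ≤ z → regionCode (f z) = regionCode z := by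
  obtain ⟨k, hk | hk⟩ := (regionCode x).even_or_odd'
  · refine ⟨id, strictMono_id, ?_, fun _ _ => rfl⟩
    rw [id, (regionCode_eq_even hx).1 hk, (regionCode_eq_even hx').1 (h ▸ hk)]
  · obtain ⟨h1, h2⟩ := (regionCode_eq_odd hx).1 hk
    obtain ⟨h1', h2'⟩ := (regionCode_eq_odd hx').1 (h ▸ hk)
    -- the affine map that fixes `k + 1` and takes `x` to `x'`, and the identity beyond `k + 1`
    set l : ℝ := (k + 1 - x') / (k + 1 - x) with hl
    have hx0 : (0 : ℝ) < k + 1 - x := by linarith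
    have hl0 : 0 < l := div_pos (by linarith) hx0
    have hlx : (k + 1 - x) * l = k + 1 - x' := by rw [hl]; field_simp
    refine ⟨fun z => if z < k + 1 then k + 1 - (k + 1 - z) * l else z, ?_, ?_, ?_⟩
    · intro z w hzw
      beta_reduce
      split_ifs with hz hw hw
      · nlinarith
      · have := mul_pos (sub_pos.2 hz) hl0
        linarith
      · linarith
      · exact hzw
    · beta_reduce
      rw [if_pos h2, hlx]
      ring
    · intro z hz
      beta_reduce
      split_ifs with hz'
      · have e1 := mul_pos (sub_pos.2 hz') hl0
        have e2 : (k + 1 - z) * l ≤ k + 1 - x' := by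
          rw [← hlx]
          gcongr
        rw [(regionCode_eq_odd (k := k) (by linarith)).2 ⟨by linarith, by linarith⟩,
          (regionCode_eq_odd (k := k) (by linarith)).2 ⟨by linarith, by linarith⟩]
      · rfl

/-- Along given regions and resets, a timing from one point of a region gives a timing from any
other point, which has its proper delays at the same moves. -/
lemma exists_timing_of_regionCode_eq (hx : 0 ≤ x) (hx' : 0 ≤ x')
    (h : regionCode x = regionCode x') (hy : y ∈ timings R j x) :
    ∃ y' ∈ timings R j x', ∀ k, (clockBefore x' R y' k < y' k ↔ clockBefore x R y k < y k) := by
  obtain ⟨f, hf, rfl, hc⟩ := exists_strictMono_regionCode hx hx' h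
  refine ⟨retime f R y, fun k => ?_, fun k => ?_⟩
  · rcases retime_cases f (fun k => (hy k).1) k with ⟨h1, h2⟩ | ⟨h0, h1, h2⟩
    · rw [h1, h2]
      exact hy k
    · rw [h1, h2, hf.le_iff_le, hc _ (h0.trans (hy k).1)]
      exact hy k
  · rcases retime_cases f (fun k => (hy k).1) k with ⟨h1, h2⟩ | ⟨h0, h1, h2⟩
    · rw [h1, h2]
    · rw [h1, h2, hf.lt_iff_lt]

lemma timingCost_cons (r d : ℕ → ℤ) (x : ℝ) (R : ℕ → Prop) (y : ℕ → ℝ) (n : ℕ) :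
    timingCost r d x R y (n + 1) =
      timingCost (fun i => r (i + 1)) (fun i => d (i + 1)) (clockBefore x R y 1)
        (fun i => R (i + 1)) (fun i => y (i + 1)) n + (r 0 * (y 0 - x) + d 0) := by
  rw [timingCost, Finset.sum_range_succ', timingCost]
  refine congrArg₂ _ (Finset.sum_congr rfl fun k _ => ?_) rfl
  rw [clockBefore_cons]

lemma mem_timings_cons : y ∈ timings R j x ↔ x ≤ y 0 ∧ regionCode (y 0) = j 0 ∧
    (fun i => y (i + 1)) ∈
      timings (fun i => R (i + 1)) (fun i => j (i + 1)) (clockBefore x R y 1) := by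
  constructor
  · intro h
    refine ⟨(h 0).1, (h 0).2, fun k => ?_⟩
    rw [← clockBefore_cons]
    exact h (k + 1)
  · rintro ⟨h1, h2, h3⟩ k
    cases k with
    | zero => exact ⟨h1, h2⟩
    | succ k =>
      rw [clockBefore_cons]
      exact h3 k

/-- The infimum of the costs of the first `n` moves, over all timings through given regions, is
affine in the initial clock value within its region: spending all the time up to the right end point of the
region at the extremal available rate is optimal in the limit. Rates of both signs are allowed, so
that suprema are covered as well. -/
lemma hasProfile_timingCost {Q : Set ℤ} (h0 : (0 : ℤ) ∈ Q) (n : ℕ) :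
    ∀ (R : ℕ → Prop) (j : ℕ → ℕ) (r d : ℕ → ℤ) (x₀ : ℝ), 0 ≤ x₀ → (timings R j x₀).Nonempty →
      (∀ k, r k ∈ Q) →
      HasProfile Q (regionCode x₀) fun x u => ∃ y ∈ timings R j x, timingCost r d x R y n ≤ u := by
  induction n with
  | zero =>
    intro R j r d x₀ hx₀ ⟨y₀, hy₀⟩ hr
    refine (HasProfile.zero h0).congr fun x hx hxj u => ?_
    obtain ⟨y, hy, -⟩ := exists_timing_of_regionCode_eq hx₀ hx hxj.symm hy₀
    simp only [timingCost, Finset.range_zero, Finset.sum_empty]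
    exact ⟨fun ⟨_, _, h⟩ => h, fun h => ⟨y, hy, h⟩⟩
  | succ n ih =>
    intro R j r d x₀ hx₀ ⟨y₀, hy₀⟩ hr
    obtain ⟨h1, h2, h3⟩ := mem_timings_cons.1 hy₀
    have H := ih _ _ (fun i => r (i + 1)) (fun i => d (i + 1)) _
      (clockBefore_nonneg hx₀ (fun k => (hy₀ k).1) 1) ⟨_, h3⟩ fun k => hr (k + 1)
    set G : ℝ → ℝ → Prop := fun x u =>
      ∃ y ∈ timings (fun i => R (i + 1)) (fun i => j (i + 1)) x,
        timingCost (fun i => r (i + 1)) (fun i => d (i + 1)) x (fun i => R (i + 1)) y n ≤ u with hG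
    have H' : HasProfile Q (j 0) fun z u => G (clockBefore 0 R (fun _ => z) 1) u := by
      by_cases hR : R 0
      · rw [clockBefore_succ_of_reset hR] at H
        have e : regionCode 0 = 0 := by simp [regionCode]
        rw [e] at H
        simp only [clockBefore_succ_of_reset hR]
        exact H.reset h0 _
      · rw [clockBefore_succ_of_not hR, h2] at H
        simpa only [clockBefore_succ_of_not hR] using H
    have hj : regionCode x₀ ≤ j 0 := h2 ▸ regionCode_mono h1
    refine ((H'.sub_const (d 0)).delay (hr 0) hj).congr fun x hx hxj u => ⟨?_, ?_⟩
    · rintro ⟨y, hy, hu⟩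
      obtain ⟨e1, e2, e3⟩ := mem_timings_cons.1 hy
      refine ⟨y 0, e1, e2, _, e3, ?_⟩
      rw [timingCost_cons] at hu
      change timingCost _ _ (clockBefore x R y 1) _ _ n ≤ _
      linarith
    · rintro ⟨z, e1, e2, y, e3, hu⟩
      let w : ℕ → ℝ := fun k => Nat.casesOn k z y
      refine ⟨w, (mem_timings_cons (y := w)).2 ⟨e1, e2, e3⟩, ?_⟩
      rw [timingCost_cons]
      change timingCost _ _ (clockBefore 0 R (fun _ => z) 1) _ y n + ((r 0 : ℝ) * (z - x) + d 0) ≤ u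
      linarith

/-! ### Thresholds on the cost -/

lemma regionCode_eq_int {x x' : ℝ} (hx : 0 ≤ x) (hx' : 0 ≤ x')
    (h : regionCode x = regionCode x') (m : ℤ) :
    (x < m ↔ x' < m) ∧ ((m : ℝ) < x ↔ (m : ℝ) < x') := by
  rcases lt_or_ge m 0 with hm | hm
  · have hm' : (m : ℝ) < 0 := by exact_mod_cast hm
    exact ⟨by constructor <;> intro <;> linarith, by constructor <;> intro <;> linarith⟩
  · lift m to ℕ using hm
    exact_mod_cast (regionCode_eq_iff hx hx').1 h m

/-- The slopes that do not distinguish points within a region of granularity `1 / C`. -/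
def slopes (C : ℕ) : Set ℤ := {ρ | ρ = 0 ∨ ρ ∣ C}

lemma neg_mem_slopes {C : ℕ} {ρ : ℤ} (h : ρ ∈ slopes C) : -ρ ∈ slopes C := by
  rcases h with rfl | h
  exacts [Or.inl neg_zero, Or.inr (neg_dvd.2 h)]

lemma slope_mul_lt_iff {C : ℕ} (hC : 0 < C) (hx : 0 ≤ x) (hx' : 0 ≤ x')
    (h : regionCode (C * x) = regionCode (C * x')) {ρ : ℤ} (hρ : ρ ∈ slopes C) (m : ℤ) :
    ((ρ : ℝ) * (⌈x⌉₊ - x) < m ↔ (ρ : ℝ) * (⌈x'⌉₊ - x') < m) := by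
  rcases hρ with rfl | ⟨e, he⟩
  · simp
  have h1 := regionCode_of_mul hx hx' hC h
  have hceil : ⌈x⌉₊ = ⌈x'⌉₊ := eq_of_forall_ge_iff fun m => by
    rw [Nat.ceil_le, Nat.ceil_le, ← not_lt, ← not_lt, ((regionCode_eq_iff hx hx').1 h1 m).2]
  have he' : (C : ℝ) = ρ * e := by exact_mod_cast he
  have hC' : (0 : ℝ) < C := by exact_mod_cast hC
  have h2 := regionCode_eq_int (by positivity) (by positivity) h (C * ⌈x⌉₊ - m * e)
  push_cast at h2
  rw [← hceil]
  -- the condition on `x` compares `C * x` with the integer `C * ⌈x⌉₊ - m * e`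
  have key : ∀ z : ℝ, ((ρ : ℝ) * (⌈x⌉₊ - z)) * e = C * ⌈x⌉₊ - C * z := fun z => by rw [he']; ring
  rcases lt_trichotomy e 0 with h0 | h0 | h0
  · have h0' : (e : ℝ) < 0 := by exact_mod_cast h0
    rw [← mul_lt_mul_right_of_neg h0', key, ← mul_lt_mul_right_of_neg (b := (ρ : ℝ) * _) h0', key]
    constructor <;> intro h3
    · linarith [h2.1.1 (by linarith)]
    · linarith [h2.1.2 (by linarith)]
  · simp [h0] at he
    omega
  · have h0' : (0 : ℝ) < e := by exact_mod_cast h0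
    rw [← mul_lt_mul_iff_left₀ h0', key, ← mul_lt_mul_iff_left₀ (b := (ρ : ℝ) * _) h0', key]
    constructor <;> intro h3
    · linarith [h2.2.1 (by linarith)]
    · linarith [h2.2.2 (by linarith)]

variable {C : ℕ} {c : ℤ}

/-- The two upper threshold queries on the cost of a region path have the same answers at any two
points of a region of granularity `1 / C`, if the rates divide `C`. -/
lemma exists_timing_cost_le_and_lt (hC : 0 < C) (hx : 0 ≤ x) (hx' : 0 ≤ x')
    (h : regionCode (C * x) = regionCode (C * x')) (hr : ∀ k, r k ∈ slopes C)
    (hy : y ∈ timings R j x) :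
    (timingCost r d x R y n ≤ c → ∃ y' ∈ timings R j x', timingCost r d x' R y' n ≤ c) ∧
    (timingCost r d x R y n < c → ∃ y' ∈ timings R j x', timingCost r d x' R y' n < c) := by
  obtain ⟨ρ, hρ, a, b, H⟩ := hasProfile_timingCost (Or.inl rfl) n R j r d x hx ⟨y, hy⟩ hr
  have h1 := (regionCode_of_mul hx hx' hC h).symm
  have hlt := slope_mul_lt_iff hC hx hx' h hρ (c - a)
  have hneg := slope_mul_lt_iff hC hx hx' h (neg_mem_slopes hρ) (a - c)
  push_cast at hlt hneg
  constructor
  · intro hc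
    refine (H x' hx' h1 c).2 ?_
    rcases (H x hx rfl c).1 ⟨y, hy, hc⟩ with h2 | ⟨hb, h2⟩
    · left
      linarith [hlt.1 (by linarith)]
    · have h3 : ¬ (ρ : ℝ) * (⌈x'⌉₊ - x') < c - a := fun h3 => by linarith [hlt.2 h3]
      have h4 : ¬ -(ρ : ℝ) * (⌈x'⌉₊ - x') < a - c := fun h4 => by linarith [hneg.2 h4]
      exact Or.inr ⟨hb, by linarith⟩
  · intro hc
    have h2 : (ρ : ℝ) * (⌈x⌉₊ - x) + a ≤ timingCost r d x R y n := by
      rcases (H x hx rfl _).1 ⟨y, hy, le_rfl⟩ with h2 | ⟨-, h2⟩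
      exacts [h2.le, h2.le]
    have h3 := hlt.1 (by linarith)
    obtain ⟨u, hu1, hu2⟩ := exists_between (lt_sub_iff_add_lt.1 h3)
    obtain ⟨y', hy', h4⟩ := (H x' hx' h1 u).2 (Or.inl hu1)
    exact ⟨y', hy', h4.trans_lt hu2⟩

lemma timingCost_neg : timingCost (fun k => -r k) (fun k => -d k) x R y n =
    -timingCost r d x R y n := by
  rw [timingCost, timingCost, ← Finset.sum_neg_distrib]
  refine Finset.sum_congr rfl fun k _ => ?_
  push_cast
  ring

lemma exists_timing_le_cost_and_lt (hC : 0 < C) (hx : 0 ≤ x) (hx' : 0 ≤ x')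
    (h : regionCode (C * x) = regionCode (C * x')) (hr : ∀ k, r k ∈ slopes C)
    (hy : y ∈ timings R j x) :
    (c ≤ timingCost r d x R y n → ∃ y' ∈ timings R j x', c ≤ timingCost r d x' R y' n) ∧
    (c < timingCost r d x R y n → ∃ y' ∈ timings R j x', c < timingCost r d x' R y' n) := by
  have H := exists_timing_cost_le_and_lt (r := fun k => -r k) (d := fun k => -d k) (n := n)
    (c := -c) hC hx hx' h (fun k => neg_mem_slopes (hr k)) hy
  simpa only [timingCost_neg, Int.cast_neg, neg_le_neg_iff, neg_lt_neg_iff] using H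

lemma comb_mem_timings {s t : ℝ} (hs : 0 ≤ s) (ht : 0 ≤ t) (hst : s + t = 1)
    (hy : y ∈ timings R j x) (hy' : y' ∈ timings R j x) :
    (fun i => s * y i + t * y' i) ∈ timings R j x := by
  refine fun k => ⟨?_, ?_⟩
  · rw [clockBefore_comb s t x hst]
    have h1 := mul_le_mul_of_nonneg_left (hy k).1 hs
    have h2 := mul_le_mul_of_nonneg_left (hy' k).1 ht
    exact add_le_add h1 h2
  · have h1 : Convex ℝ (regionCode ⁻¹' {j k}) :=
      (Set.ordConnected_singleton.preimage_mono regionCode_mono).convex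
    exact h1 (hy k).2 (hy' k).2 hs ht hst

lemma timingCost_comb {s t : ℝ} (hst : s + t = 1) :
    timingCost r d x R (fun i => s * y i + t * y' i) n =
      s * timingCost r d x R y n + t * timingCost r d x R y' n := by
  rw [timingCost, timingCost, timingCost, Finset.mul_sum, Finset.mul_sum, ← Finset.sum_add_distrib]
  refine Finset.sum_congr rfl fun k _ => ?_
  rw [clockBefore_comb s t x hst]
  linear_combination (-(d k : ℝ)) * hst

lemma exists_comb_eq {a b c : ℝ} (ha : a ≤ c) (hb : c ≤ b) :
    ∃ s t : ℝ, 0 ≤ s ∧ 0 ≤ t ∧ s + t = 1 ∧ s * a + t * b = c := by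
  obtain ⟨s, t, hs, ht, hst, h⟩ := (segment_eq_Icc (𝕜 := ℝ) (ha.trans hb)).symm ▸
    Set.mem_Icc.2 ⟨ha, hb⟩
  exact ⟨s, t, hs, ht, hst, h⟩

lemma exists_timing_cost_eq (hC : 0 < C) (hx : 0 ≤ x) (hx' : 0 ≤ x')
    (h : regionCode (C * x) = regionCode (C * x')) (hr : ∀ k, r k ∈ slopes C)
    (hy : y ∈ timings R j x) (hc : timingCost r d x R y n = c) :
    ∃ y' ∈ timings R j x', timingCost r d x' R y' n = c := by
  obtain ⟨y₁, hy₁, h₁⟩ := (exists_timing_cost_le_and_lt hC hx hx' h hr hy).1 hc.le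
  obtain ⟨y₂, hy₂, h₂⟩ := (exists_timing_le_cost_and_lt hC hx hx' h hr hy).1 hc.ge
  obtain ⟨s, t, hs, ht, hst, H⟩ := exists_comb_eq h₁ h₂
  exact ⟨_, comb_mem_timings hs ht hst hy₁ hy₂, (timingCost_comb hst).trans H⟩

/-- Two thresholds at once. By convexity of the set of timings it suffices to satisfy each of the
inequalities separately, together with the strict inequality between the two costs. -/
lemma exists_timing_cost_lt_cost (hC : 0 < C) (hx : 0 ≤ x) (hx' : 0 ≤ x')
    (h : regionCode (C * x) = regionCode (C * x')) (hr : ∀ k, r k ∈ slopes C)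
    {m n : ℕ} (hmono : ∀ x, ∀ y ∈ timings R j x, timingCost r d x R y m ≤ timingCost r d x R y n)
    (hgap : ∃ y ∈ timings R j x', timingCost r d x' R y m < timingCost r d x' R y n)
    (hy : y ∈ timings R j x) (hm : timingCost r d x R y m < c) (hn : c < timingCost r d x R y n) :
    ∃ y' ∈ timings R j x', timingCost r d x' R y' m < c ∧ c < timingCost r d x' R y' n := by
  obtain ⟨y₁, hy₁, h₁⟩ := (exists_timing_cost_le_and_lt hC hx hx' h hr hy).2 hm
  obtain ⟨y₂, hy₂, h₂⟩ := (exists_timing_le_cost_and_lt hC hx hx' h hr hy).2 hn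
  obtain ⟨y₃, hy₃, h₃⟩ := hgap
  -- move `y₁` and `y₂` slightly towards `y₃`, so that the two costs differ
  have near : ∀ u v : ℝ, 0 < u → ∃ s t : ℝ, 0 ≤ s ∧ 0 < t ∧ s + t = 1 ∧ 0 < s * u + t * v := by
    intro u v hu
    refine ⟨1 - u / (2 * (u + |v|)), u / (2 * (u + |v|)), ?_, by positivity, by ring, ?_⟩
    · rw [sub_nonneg, div_le_one (by positivity)]
      linarith [abs_nonneg v]
    · have e : (1 - u / (2 * (u + |v|))) * u + u / (2 * (u + |v|)) * v =
          u * (u + 2 * |v| + v) / (2 * (u + |v|)) := by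
        have : u + |v| ≠ 0 := by positivity
        field_simp
        ring
      rw [e]
      have : 0 < u + 2 * |v| + v := by linarith [abs_nonneg v, neg_abs_le v]
      positivity
  obtain ⟨y₁, hy₁, h₁, g₁⟩ : ∃ y₁ ∈ timings R j x', timingCost r d x' R y₁ m < c ∧
      timingCost r d x' R y₁ m < timingCost r d x' R y₁ n := by
    obtain ⟨s, t, hs, ht, hst, H⟩ := near _ (c - timingCost r d x' R y₃ m) (sub_pos.2 h₁)
    refine ⟨_, comb_mem_timings hs ht.le hst hy₁ hy₃, ?_, ?_⟩
    · rw [timingCost_comb hst]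
      have e : (c : ℝ) = s * c + t * c := by rw [← add_mul, hst, one_mul]
      linarith
    · rw [timingCost_comb hst, timingCost_comb hst]
      have := mul_lt_mul_of_pos_left h₃ ht
      have := mul_le_mul_of_nonneg_left (hmono _ _ hy₁) hs
      linarith
  obtain ⟨y₂, hy₂, h₂, g₂⟩ : ∃ y₂ ∈ timings R j x', c < timingCost r d x' R y₂ n ∧
      timingCost r d x' R y₂ m < timingCost r d x' R y₂ n := by
    obtain ⟨s, t, hs, ht, hst, H⟩ := near _ (timingCost r d x' R y₃ n - c) (sub_pos.2 h₂)
    refine ⟨_, comb_mem_timings hs ht.le hst hy₂ hy₃, ?_, ?_⟩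
    · rw [timingCost_comb hst]
      have e : (c : ℝ) = s * c + t * c := by rw [← add_mul, hst, one_mul]
      linarith
    · rw [timingCost_comb hst, timingCost_comb hst]
      have := mul_lt_mul_of_pos_left h₃ ht
      have := mul_le_mul_of_nonneg_left (hmono _ _ hy₂) hs
      linarith
  by_cases h4 : c < timingCost r d x' R y₁ n
  · exact ⟨y₁, hy₁, h₁, h4⟩
  by_cases h5 : timingCost r d x' R y₂ m < c
  · exact ⟨y₂, hy₂, h5, h₂⟩
  push Not at h4 h5
  -- choose the combination for which `c` is the mean of the two costs
  obtain ⟨s, t, hs, ht, hst, H⟩ := exists_comb_eq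
    (a := (timingCost r d x' R y₁ m + timingCost r d x' R y₁ n) / 2)
    (b := (timingCost r d x' R y₂ m + timingCost r d x' R y₂ n) / 2) (c := c)
    (by linarith) (by linarith)
  have gap : 0 < s * (timingCost r d x' R y₁ n - timingCost r d x' R y₁ m) +
      t * (timingCost r d x' R y₂ n - timingCost r d x' R y₂ m) := by
    rcases hs.eq_or_lt with rfl | hs
    · have : t = 1 := by linarith
      subst this
      linarith
    · have := mul_pos hs (sub_pos.2 g₁)
      have := mul_nonneg ht (sub_pos.2 g₂).le
      linarith
  refine ⟨_, comb_mem_timings hs ht hst hy₁ hy₂, ?_, ?_⟩ <;>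
  · rw [timingCost_comb hst]
    linarith

end PricedTimed

namespace PricedTimed

/-! ### Trajectories of one-clock automata -/

variable {X Loc : Type*} {p : ℕ}

/-- The guard `g` holds at the clock value `z`. -/
def Guard.HoldsAt (g : Guard X) (z : ℝ) : Prop := g.Holds fun _ => z.toNNReal

/-- The comparison of real numbers named by a comparison operator. -/
def Cmp.HoldsReal : Cmp → ℝ → ℝ → Prop
  | .lt, a, b => a < b
  | .le, a, b => a ≤ b
  | .eq, a, b => a = b
  | .ge, a, b => b ≤ a
  | .gt, a, b => b < a

lemma Cmp.holds_iff (r : Cmp) (a b : ℝ≥0) : r.Holds a b ↔ r.HoldsReal a b := by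
  cases r <;> simp [Cmp.Holds, Cmp.HoldsReal]

/-- No clock constraint with constants at most `M` distinguishes the clock values `z` and `z'`. -/
def GuardEquiv (M : ℕ) (z z' : ℝ) : Prop :=
  ∀ m : ℕ, m ≤ M → (z < m ↔ z' < m) ∧ ((m : ℝ) < z ↔ (m : ℝ) < z')

lemma GuardEquiv.refl (M : ℕ) (z : ℝ) : GuardEquiv M z z := fun _ _ => ⟨Iff.rfl, Iff.rfl⟩

lemma GuardEquiv.symm {M : ℕ} {z z' : ℝ} (h : GuardEquiv M z z') : GuardEquiv M z' z :=
  fun m hm => ⟨(h m hm).1.symm, (h m hm).2.symm⟩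

lemma GuardEquiv.trans {M : ℕ} {z z' z'' : ℝ} (h : GuardEquiv M z z') (h' : GuardEquiv M z' z'') :
    GuardEquiv M z z'' :=
  fun m hm => ⟨(h m hm).1.trans (h' m hm).1, (h m hm).2.trans (h' m hm).2⟩

lemma guardEquiv_of_regionCode {M N : ℕ} (hN : 0 < N) {z z' : ℝ} (hz : 0 ≤ z) (hz' : 0 ≤ z')
    (h : regionCode (N * z) = regionCode (N * z')) : GuardEquiv M z z' := fun m _ =>
  (regionCode_eq_iff hz hz').1 (regionCode_of_mul hz hz' hN h) m

lemma guardEquiv_of_lt {M : ℕ} {z z' : ℝ} (hz : (M : ℝ) < z) (hz' : (M : ℝ) < z') :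
    GuardEquiv M z z' := fun m hm => by
  have : (m : ℝ) ≤ M := by exact_mod_cast hm
  exact ⟨iff_of_false (by linarith) (by linarith), iff_of_true (by linarith) (by linarith)⟩

lemma Guard.holdsAt_congr {g : Guard X} {M : ℕ} (hM : ∀ m ∈ g.consts, m ≤ M) {z z' : ℝ}
    (hz : 0 ≤ z) (hz' : 0 ≤ z') (h : GuardEquiv M z z') : g.HoldsAt z ↔ g.HoldsAt z' := by
  induction g with
  | atom x r c =>
    obtain ⟨h1, h2⟩ := h c (hM c (by simp [Guard.consts]))
    simp only [HoldsAt, Holds, Cmp.holds_iff, Real.coe_toNNReal z hz, Real.coe_toNNReal z' hz',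
      NNReal.coe_natCast]
    cases r
    · exact h1
    · exact not_lt.symm.trans (h2.not.trans not_lt)
    · simp only [Cmp.HoldsReal, le_antisymm_iff, ← not_lt, h1, h2]
    · exact not_lt.symm.trans (h1.not.trans not_lt)
    · exact h2
  | and g₁ g₂ ih₁ ih₂ =>
    have e1 := ih₁ fun m hm => hM m (Finset.mem_union_left _ hm)
    have e2 := ih₂ fun m hm => hM m (Finset.mem_union_right _ hm)
    exact and_congr e1 e2

namespace PTA

/-- A mixed move in terms of clock values: `x` before the delay, `y` after the delay, and `w` after
the transition `e`. -/
structure Step (A : PTA X Loc p) (x : ℝ) (e : Edge X Loc) (y w : ℝ) : Prop where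
  le : x ≤ y
  mem : e ∈ A.edges
  inv : ∀ z, x ≤ z → z ≤ y → (A.inv e.src).HoldsAt z
  guard : e.guard.HoldsAt y
  inv_tgt : (A.inv e.tgt).HoldsAt w

lemma Run.src_edge {A : PTA X Loc p} (ρ : A.Run) (k : ℕ) : (ρ.edge k).src = (ρ.state k).1 := by
  obtain ⟨s, ⟨-, rfl⟩, -, h, -⟩ := ρ.step k
  exact h

section Consts
variable [Fintype Loc] {A : PTA X Loc p}

lemma le_maxConst_of_inv {q : Loc} {m : ℕ} (hm : m ∈ (A.inv q).consts) : m ≤ A.maxConst :=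
  Finset.le_sup (f := id) (Finset.mem_union_right _
    (Finset.mem_biUnion.2 ⟨q, Finset.mem_univ q, hm⟩))

lemma le_maxConst_of_guard {e : Edge X Loc} (he : e ∈ A.edges) {m : ℕ} (hm : m ∈ e.guard.consts) :
    m ≤ A.maxConst :=
  Finset.le_sup (f := id) (Finset.mem_union_left _ (Finset.mem_biUnion.2 ⟨e, he, hm⟩))

lemma Step.congr {x x' y y' w w' : ℝ} {e : Edge X Loc} (h : A.Step x e y w) (hx : 0 ≤ x)
    (hx' : 0 ≤ x') (hw : 0 ≤ w) (hw' : 0 ≤ w') (hxy : x' ≤ y') (h₁ : GuardEquiv A.maxConst x x')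
    (h₂ : GuardEquiv A.maxConst y y') (h₃ : GuardEquiv A.maxConst w w') : A.Step x' e y' w' where
  le := hxy
  mem := h.mem
  guard := (Guard.holdsAt_congr (fun _ => le_maxConst_of_guard h.mem) (hx.trans h.le)
    (hx'.trans hxy) h₂).1 h.guard
  inv_tgt := (Guard.holdsAt_congr (fun _ => le_maxConst_of_inv) hw hw' h₃).1 h.inv_tgt
  inv z hz hzy := by
    -- the point of `[x, y]` closest to `z` is equivalent to `z`
    obtain ⟨z₀, h1, h2, h3⟩ : ∃ z₀, x ≤ z₀ ∧ z₀ ≤ y ∧ GuardEquiv A.maxConst z₀ z := by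
      rcases lt_or_ge z x with hzx | hzx
      · refine ⟨x, le_rfl, h.le, fun m hm => ⟨⟨hzx.trans, fun h' => ?_⟩,
          fun h' => ?_, fun h' => h'.trans hzx⟩⟩
        · exact (h₁ m hm).1.2 (hz.trans_lt h')
        · exact ((h₁ m hm).2.1 h').trans_le hz
      rcases lt_or_ge y z with hzy' | hzy'
      · refine ⟨y, h.le, le_rfl, fun m hm => ⟨⟨fun h' => ?_, hzy'.trans⟩,
          fun h' => h'.trans hzy', fun h' => ?_⟩⟩
        · exact hzy.trans_lt ((h₂ m hm).1.1 h')
        · exact (h₂ m hm).2.2 (h'.trans_le hzy)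
      · exact ⟨z, hzx, hzy', GuardEquiv.refl _ _⟩
    exact (Guard.holdsAt_congr (fun _ => le_maxConst_of_inv) (hx.trans h1) (hx'.trans hz) h3).1
      (h.inv z₀ h1 h2)

lemma rateLcm_pos (A : PTA X Loc p) : 0 < A.rateLcm := by
  refine Nat.pos_of_ne_zero fun h => ?_
  obtain ⟨iq, h1, h2⟩ := Finset.lcm_eq_zero_iff.1 h
  exact (Finset.mem_filter.1 h1).2.ne' h2

lemma locCost_mem_slopes (A : PTA X Loc p) (i : Fin p) (q : Loc) :
    (A.locCost i q : ℤ) ∈ slopes A.rateLcm := by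
  rcases Nat.eq_zero_or_pos (A.locCost i q) with h | h
  · exact Or.inl (by exact_mod_cast h)
  · refine Or.inr ?_
    have : A.locCost i q ∣ A.rateLcm :=
      Finset.dvd_lcm (f := fun iq : Fin p × Loc => A.locCost iq.1 iq.2) (b := (i, q))
        (Finset.mem_filter.2 ⟨Finset.mem_univ _, h⟩)
    exact_mod_cast this

end Consts

end PTA

variable [Unique X]

/-- The moves of a sequence of transitions at which the clock is reset. -/
def resetsOf (e : ℕ → Edge X Loc) (k : ℕ) : Prop := default ∈ (e k).resets

namespace PTA

variable (A : PTA X Loc p)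

/-- The sequence of transitions `e` and of clock values `y` before them is an infinite run from the
location `(e 0).src` and the clock value `x`. -/
structure IsTrajectory (x : ℝ) (e : ℕ → Edge X Loc) (y : ℕ → ℝ) : Prop where
  src_succ : ∀ k, (e (k + 1)).src = (e k).tgt
  step : ∀ k, A.Step (clockBefore x (resetsOf e) y k) (e k) (y k)
    (clockBefore x (resetsOf e) y (k + 1))

/-- The `i`-th cost of the first `n` moves. -/
noncomputable def cost (i : Fin p) (x : ℝ) (e : ℕ → Edge X Loc) (y : ℕ → ℝ) (n : ℕ) : ℝ :=
  timingCost (fun k => A.locCost i (e k).src) (fun k => A.edgeCost i (e k)) x (resetsOf e) y n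

variable {A} {i : Fin p} {x : ℝ} {e : ℕ → Edge X Loc} {y : ℕ → ℝ}

lemma cost_eq_sum (n : ℕ) : A.cost i x e y n = ∑ k ∈ Finset.range n,
    ((A.locCost i (e k).src : ℝ) * (y k - clockBefore x (resetsOf e) y k) +
      A.edgeCost i (e k)) := by
  simp [cost, timingCost]

lemma cost_zero : A.cost i x e y 0 = 0 := by simp [cost_eq_sum]

lemma cost_succ (n : ℕ) : A.cost i x e y (n + 1) = A.cost i x e y n +
    ((A.locCost i (e n).src : ℝ) * (y n - clockBefore x (resetsOf e) y n) +
      A.edgeCost i (e n)) := by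
  rw [cost_eq_sum, Finset.sum_range_succ, ← cost_eq_sum]

lemma cost_add (n k : ℕ) : A.cost i x e y (n + k) = A.cost i x e y n +
    A.cost i (clockBefore x (resetsOf e) y n) (fun k => e (n + k)) (fun k => y (n + k)) k := by
  rw [cost_eq_sum, Finset.sum_range_add, ← cost_eq_sum, cost_eq_sum k]
  congr 1
  refine Finset.sum_congr rfl fun m _ => ?_
  rw [clockBefore_add]
  rfl

lemma cost_congr {x' : ℝ} {e' : ℕ → Edge X Loc} {y' : ℕ → ℝ} {n : ℕ}
    (h : ∀ k < n, e k = e' k ∧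
      y k - clockBefore x (resetsOf e) y k = y' k - clockBefore x' (resetsOf e') y' k) :
    A.cost i x e y n = A.cost i x' e' y' n := by
  rw [cost_eq_sum, cost_eq_sum]
  refine Finset.sum_congr rfl fun k hk => ?_
  obtain ⟨h1, h2⟩ := h k (Finset.mem_range.1 hk)
  rw [h1, h2]

lemma cost_mono (h : ∀ k, clockBefore x (resetsOf e) y k ≤ y k) : Monotone (A.cost i x e y) := by
  refine monotone_nat_of_le_succ fun n => ?_
  rw [cost_succ]
  have := mul_nonneg (Nat.cast_nonneg (α := ℝ) (A.locCost i (e n).src)) (sub_nonneg.2 (h n))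
  have := Nat.cast_nonneg (α := ℝ) (A.edgeCost i (e n))
  linarith

lemma cost_nonneg (h : ∀ k, clockBefore x (resetsOf e) y k ≤ y k) (n : ℕ) :
    0 ≤ A.cost i x e y n :=
  cost_zero (A := A) (i := i) (x := x) (e := e) (y := y) ▸ cost_mono h (Nat.zero_le n)

lemma IsTrajectory.le (h : A.IsTrajectory x e y) (k : ℕ) :
    clockBefore x (resetsOf e) y k ≤ y k := (h.step k).le

lemma IsTrajectory.nonneg (h : A.IsTrajectory x e y) (hx : 0 ≤ x) (k : ℕ) :
    0 ≤ clockBefore x (resetsOf e) y k := clockBefore_nonneg hx h.le k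

lemma IsTrajectory.tail (h : A.IsTrajectory x e y) (n : ℕ) :
    A.IsTrajectory (clockBefore x (resetsOf e) y n) (fun k => e (n + k)) (fun k => y (n + k)) where
  src_succ k := h.src_succ (n + k)
  step k := by
    have h1 := h.step (n + k)
    rw [add_assoc, clockBefore_add, clockBefore_add] at h1
    exact h1

/-- A trajectory may be continued by another one from the location and the clock value reached. -/
lemma IsTrajectory.splice (h : A.IsTrajectory x e y) {n : ℕ} {e' : ℕ → Edge X Loc} {y' : ℕ → ℝ}
    (h' : A.IsTrajectory (clockBefore x (resetsOf e) y n) e' y') (hsrc : (e' 0).src = (e n).src)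
    (i : Fin p) :
    ∃ e₁ y₁, A.IsTrajectory x e₁ y₁ ∧ (e₁ 0).src = (e 0).src ∧
      (∀ k ≤ n, A.cost i x e₁ y₁ k = A.cost i x e y k) ∧
      ∀ k, A.cost i x e₁ y₁ (n + k) = A.cost i x e y n +
        A.cost i (clockBefore x (resetsOf e) y n) e' y' k := by
  set e₁ : ℕ → Edge X Loc := fun k => if k < n then e k else e' (k - n) with he₁
  set y₁ : ℕ → ℝ := fun k => if k < n then y k else y' (k - n) with hy₁
  have a1 : ∀ k < n, e₁ k = e k := fun k hk => if_pos hk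
  have a2 : ∀ k < n, y₁ k = y k := fun k hk => if_pos hk
  have b1 : ∀ k, e₁ (n + k) = e' k := fun k => by simp [he₁]
  have b2 : ∀ k, y₁ (n + k) = y' k := fun k => by simp [hy₁]
  have a3 : ∀ k ≤ n, clockBefore x (resetsOf e₁) y₁ k = clockBefore x (resetsOf e) y k :=
    fun k hk => clockBefore_congr fun i hi => by
      simp [resetsOf, a1 i (hi.trans_le hk), a2 i (hi.trans_le hk)]
  have b3 : ∀ k, clockBefore x (resetsOf e₁) y₁ (n + k) =
      clockBefore (clockBefore x (resetsOf e) y n) (resetsOf e') y' k := fun k => by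
    rw [clockBefore_add, a3 n le_rfl]
    exact clockBefore_congr fun i _ => by simp [resetsOf, b1 i, b2 i]
  have c1 : ∀ k ≤ n, A.cost i x e₁ y₁ k = A.cost i x e y k := fun k hk =>
    cost_congr fun l hl => by
      rw [a1 l (hl.trans_le hk), a2 l (hl.trans_le hk), a3 l (hl.le.trans hk)]
      exact ⟨rfl, rfl⟩
  have s0 : ∀ k ≤ n, (e₁ k).src = (e k).src := fun k hk => by
    rcases hk.lt_or_eq with hk | rfl
    · rw [a1 k hk]
    · have := b1 0
      rw [add_zero] at this
      rw [this, hsrc]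
  refine ⟨e₁, y₁, ⟨fun k => ?_, fun k => ?_⟩, s0 0 (Nat.zero_le n), c1, fun k => ?_⟩
  · rcases lt_or_ge k n with hk | hk
    · rw [s0 (k + 1) hk, a1 k hk, h.src_succ]
    · obtain ⟨l, rfl⟩ := Nat.exists_eq_add_of_le hk
      rw [add_assoc, b1, b1, h'.src_succ]
  · rcases lt_or_ge k n with hk | hk
    · rw [a3 k hk.le, a3 (k + 1) hk, a1 k hk, a2 k hk]
      exact h.step k
    · obtain ⟨l, rfl⟩ := Nat.exists_eq_add_of_le hk
      rw [add_assoc, b1, b2, b3, b3]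
      exact h'.step l
  · rw [cost_add, c1 n le_rfl, a3 n le_rfl]
    congr 2
    · exact funext b1
    · exact funext b2

/-! ### Runs as trajectories -/

lemma valuation_eq (v : Valuation X) : v = fun _ => v default :=
  funext fun a => by rw [Unique.eq_default a]

lemma holdsAt_coe (g : Guard X) (v : Valuation X) : g.HoldsAt (v default) ↔ g.Holds v := by
  rw [Guard.HoldsAt, Real.toNNReal_coe, ← valuation_eq v]

lemma Run.clockBefore_eq (ρ : A.Run) (k : ℕ) :
    clockBefore ((ρ.state 0).2 default) (resetsOf ρ.edge)
      (fun k => (ρ.state k).2 default + ρ.dly k) k = (ρ.state k).2 default := by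
  cases k with
  | zero => rfl
  | succ k =>
    obtain ⟨s, ⟨-, rfl⟩, -, -, -, h2, -⟩ := ρ.step k
    rw [h2]
    by_cases hR : resetsOf ρ.edge k
    · rw [clockBefore_succ_of_reset hR]
      simp only [Valuation.reset]
      rw [Set.indicator_of_notMem (by simpa [resetsOf] using hR)]
      rfl
    · rw [clockBefore_succ_of_not hR]
      simp only [Valuation.reset]
      rw [Set.indicator_of_mem (by simpa [resetsOf] using hR)]
      simp [Valuation.delay]

lemma Run.isTrajectory (ρ : A.Run) : A.IsTrajectory ((ρ.state 0).2 default) ρ.edge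
    fun k => (ρ.state k).2 default + ρ.dly k where
  src_succ k := by
    rw [ρ.src_edge]
    obtain ⟨s, -, -, -, -, h, -⟩ := ρ.step k
    rw [h]
  step k := by
    rw [ρ.clockBefore_eq, ρ.clockBefore_eq]
    have hs := ρ.src_edge k
    obtain ⟨s, ⟨h1, rfl⟩, h2, h3, h4, h5, h6⟩ := ρ.step k
    refine ⟨by simp, h2, fun z hz hz' => ?_, ?_, ?_⟩
    · have h7 := h1 (z - (ρ.state k).2 default).toNNReal
        (Real.toNNReal_le_iff_le_coe.2 (by linarith))
      rw [← holdsAt_coe, ← hs] at h7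
      simp only [Valuation.delay, NNReal.coe_add] at h7
      rwa [Real.coe_toNNReal _ (by linarith), add_sub_cancel] at h7
    · rw [← holdsAt_coe] at h4
      simpa [Valuation.delay] using h4
    · rw [holdsAt_coe]
      rw [h5] at h6 ⊢
      exact h6

lemma Run.prefixCost_eq (ρ : A.Run) (i : Fin p) (n : ℕ) : (ρ.prefixCost i n : ℝ) =
    A.cost i ((ρ.state 0).2 default) ρ.edge (fun k => (ρ.state k).2 default + ρ.dly k) n := by
  rw [cost_eq_sum, Run.prefixCost]
  push_cast
  refine Finset.sum_congr rfl fun k _ => ?_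
  rw [ρ.clockBefore_eq, ρ.src_edge]
  ring

lemma IsTrajectory.exists_run (h : A.IsTrajectory x e y) (hx : 0 ≤ x) : ∃ ρ : A.Run,
    (∀ k, ρ.state k = ((e k).src, fun _ => (clockBefore x (resetsOf e) y k).toNNReal)) ∧
    ∀ i n, (ρ.prefixCost i n : ℝ) = A.cost i x e y n := by
  have hd : ∀ k, 0 ≤ y k - clockBefore x (resetsOf e) y k := fun k => sub_nonneg.2 (h.le k)
  refine ⟨⟨fun k => ((e k).src, fun _ => (clockBefore x (resetsOf e) y k).toNNReal),
    fun k => (y k - clockBefore x (resetsOf e) y k).toNNReal, e, fun k => ?_⟩, fun k => rfl,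
    fun i n => ?_⟩
  · have h1 := h.step k
    have h0 := h.nonneg hx k
    have hv : Valuation.delay (X := X) (fun _ => (clockBefore x (resetsOf e) y k).toNNReal)
        (y k - clockBefore x (resetsOf e) y k).toNNReal = fun _ => (y k).toNNReal := by
      funext a
      rw [Valuation.delay, ← Real.toNNReal_add h0 (hd k), add_sub_cancel]
    refine ⟨_, ⟨fun t ht => ?_, rfl⟩, h1.mem, rfl, ?_, ?_, ?_⟩
    · have ht' : (t : ℝ) ≤ y k - clockBefore x (resetsOf e) y k :=
        (Real.le_toNNReal_iff_coe_le (hd k)).1 ht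
      have h2 := h1.inv (clockBefore x (resetsOf e) y k + t) (by simp) (by linarith)
      have e1 : (clockBefore x (resetsOf e) y k + t).toNNReal =
          (clockBefore x (resetsOf e) y k).toNNReal + t := by
        rw [Real.toNNReal_add h0 t.coe_nonneg, Real.toNNReal_coe]
      rw [Guard.HoldsAt, e1] at h2
      exact h2
    · rw [hv]
      exact h1.guard
    · rw [hv, h.src_succ]
      congr 1
      funext a
      rw [Unique.eq_default a, Valuation.reset]
      by_cases hR : resetsOf e k
      · rw [clockBefore_succ_of_reset hR, Set.indicator_of_notMem (by simpa [resetsOf] using hR),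
          Real.toNNReal_zero]
      · rw [clockBefore_succ_of_not hR, Set.indicator_of_mem (by simpa [resetsOf] using hR)]
    · have h2 := h1.inv_tgt
      rw [← h.src_succ] at h2
      exact h2
  · rw [Run.prefixCost, cost_eq_sum]
    push_cast
    refine Finset.sum_congr rfl fun k _ => ?_
    rw [Real.coe_toNNReal _ (hd k)]
    ring

end PTA
end PricedTimed

namespace PricedTimed
namespace PTA

variable {X Loc : Type*} {p : ℕ} [Unique X] {A : PTA X Loc p} {i : Fin p} {x x' : ℝ}
  {e : ℕ → Edge X Loc} {y y' : ℕ → ℝ}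

/-! ### Trajectories through the same regions -/

/-- With the transitions `e`, the clock values `y'` from `x'` and `y` from `x` go through the same
regions of granularity `1 / N`. -/
structure Follows (N : ℕ) (e : ℕ → Edge X Loc) (x : ℝ) (y : ℕ → ℝ) (x' : ℝ) (y' : ℕ → ℝ) :
    Prop where
  le : ∀ k, clockBefore x' (resetsOf e) y' k ≤ y' k
  regionCode_start : regionCode (N * x) = regionCode (N * x')
  regionCode_eq : ∀ k, regionCode (N * y k) = regionCode (N * y' k)

lemma Follows.regionCode_clockBefore {N : ℕ} (h : Follows N e x y x' y') (k : ℕ) :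
    regionCode (N * clockBefore x (resetsOf e) y k) =
      regionCode (N * clockBefore x' (resetsOf e) y' k) := by
  rw [← clockBefore_mul, ← clockBefore_mul]
  exact PricedTimed.regionCode_clockBefore h.regionCode_start h.regionCode_eq k

lemma Follows.isTrajectory [Fintype Loc] {N : ℕ} (hN : 0 < N) (h : Follows N e x y x' y')
    (hA : A.IsTrajectory x e y) (hx : 0 ≤ x) (hx' : 0 ≤ x') : A.IsTrajectory x' e y' where
  src_succ := hA.src_succ
  step k := by
    have h1 := hA.nonneg hx
    have h2 := clockBefore_nonneg hx' h.le
    exact (hA.step k).congr (h1 k) (h2 k) (h1 _) (h2 _) (h.le k)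
      (guardEquiv_of_regionCode hN (h1 k) (h2 k) (h.regionCode_clockBefore k))
      (guardEquiv_of_regionCode hN ((h1 k).trans (hA.le k)) ((h2 k).trans (h.le k))
        (h.regionCode_eq k))
      (guardEquiv_of_regionCode hN (h1 _) (h2 _) (h.regionCode_clockBefore (k + 1)))

/-- The timings in which the clock is measured in units of `1 / N`. -/
lemma follows_iff_mem_timings {N : ℕ} (hN : 0 < N) (h : regionCode (N * x) = regionCode (N * x')) :
    Follows N e x y x' y' ↔ (fun k => N * y' k) ∈
      timings (resetsOf e) (fun k => regionCode (N * y k)) (N * x') := by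
  have hN' : (0 : ℝ) < N := by exact_mod_cast hN
  constructor
  · intro hf k
    rw [clockBefore_mul]
    exact ⟨mul_le_mul_of_nonneg_left (hf.le k) hN'.le, (hf.regionCode_eq k).symm⟩
  · intro hf
    refine ⟨fun k => ?_, h, fun k => (hf k).2.symm⟩
    have := (hf k).1
    rw [clockBefore_mul] at this
    exact le_of_mul_le_mul_left this hN'

lemma cost_mul (N : ℕ) (n : ℕ) : N * A.cost i x e y n =
    timingCost (fun k => A.locCost i (e k).src) (fun k => N * A.edgeCost i (e k)) (N * x)
      (resetsOf e) (fun k => N * y k) n := by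
  rw [cost_eq_sum, timingCost, Finset.mul_sum]
  refine Finset.sum_congr rfl fun k _ => ?_
  rw [clockBefore_mul]
  push_cast
  ring

lemma exists_follows_of_timing {N : ℕ} (hN : 0 < N) (h : regionCode (N * x) = regionCode (N * x'))
    {z : ℕ → ℝ} (hz : z ∈ timings (resetsOf e) (fun k => regionCode (N * y k)) (N * x')) :
    ∃ y', Follows N e x y x' y' ∧ z = fun k => N * y' k := by
  have hN' : (N : ℝ) ≠ 0 := by exact_mod_cast hN.ne'
  have e1 : z = fun k => (N : ℝ) * (z k / N) := funext fun k => by field_simp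
  refine ⟨fun k => z k / N, (follows_iff_mem_timings hN h).2 ?_, e1⟩
  rwa [← e1]

lemma cost_lt_cost_iff (h : ∀ k, clockBefore x (resetsOf e) y k ≤ y k) {m n : ℕ} (hmn : m ≤ n) :
    A.cost i x e y m < A.cost i x e y n ↔ ∃ k ∈ Finset.Ico m n, (0 < A.locCost i (e k).src ∧
      clockBefore x (resetsOf e) y k < y k) ∨ 0 < A.edgeCost i (e k) := by
  have hd : ∀ k, 0 ≤ (A.locCost i (e k).src : ℝ) * (y k - clockBefore x (resetsOf e) y k) :=
    fun k => mul_nonneg (Nat.cast_nonneg _) (sub_nonneg.2 (h k))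
  have h1 : ∀ k ∈ Finset.Ico m n, 0 ≤ (A.locCost i (e k).src : ℝ) *
      (y k - clockBefore x (resetsOf e) y k) + A.edgeCost i (e k) := fun k _ =>
    add_nonneg (hd k) (Nat.cast_nonneg _)
  rw [← sub_pos, cost_eq_sum, cost_eq_sum, ← Finset.sum_Ico_eq_sub _ hmn,
    Finset.sum_pos_iff_of_nonneg h1]
  refine exists_congr fun k => and_congr_right fun _ => ?_
  rcases (hd k).eq_or_lt with h2 | h2
  · rw [← h2, zero_add, Nat.cast_pos]
    refine ⟨Or.inr, fun h3 => h3.resolve_left fun ⟨h4, h5⟩ => ?_⟩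
    have h6 : (0 : ℝ) < A.locCost i (e k).src := by exact_mod_cast h4
    exact (mul_pos h6 (sub_pos.2 h5)).ne h2
  · refine iff_of_true (add_pos_of_pos_of_nonneg h2 (Nat.cast_nonneg _)) (Or.inl ⟨?_, ?_⟩)
    · exact Nat.pos_of_ne_zero fun h3 => by simp [h3] at h2
    · refine lt_of_le_of_ne (h k) fun h3 => ?_
      rw [h3, sub_self, mul_zero] at h2
      exact lt_irrefl _ h2

/-- Within a region of granularity `1 / N`, trajectories may be transferred so that the same moves
have positive cost. -/
lemma exists_follows_cost_lt_cost_iff (A : PTA X Loc p) {N : ℕ} (hN : 0 < N) (hx : 0 ≤ x)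
    (hx' : 0 ≤ x') (h : regionCode (N * x) = regionCode (N * x'))
    (hle : ∀ k, clockBefore x (resetsOf e) y k ≤ y k) :
    ∃ y', Follows N e x y x' y' ∧
      ∀ (i : Fin p) (m n : ℕ), m ≤ n →
        (A.cost i x' e y' m < A.cost i x' e y' n ↔ A.cost i x e y m < A.cost i x e y n) := by
  have hN' : (0 : ℝ) < N := by exact_mod_cast hN
  have hy := (follows_iff_mem_timings (e := e) (y := y) hN rfl).1 ⟨hle, rfl, fun _ => rfl⟩
  obtain ⟨z, hz, hd⟩ := exists_timing_of_regionCode_eq (by positivity) (by positivity) h hy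
  obtain ⟨y', hy', rfl⟩ := exists_follows_of_timing hN h hz
  have hd' : ∀ k, clockBefore x' (resetsOf e) y' k < y' k ↔
      clockBefore x (resetsOf e) y k < y k := fun k => by
    have := hd k
    rwa [clockBefore_mul, clockBefore_mul, mul_lt_mul_iff_right₀ hN', mul_lt_mul_iff_right₀ hN']
      at this
  refine ⟨y', hy', fun i m n hmn => ?_⟩
  rw [cost_lt_cost_iff hy'.le hmn, cost_lt_cost_iff hle hmn]
  simp only [hd']

section Rates

variable [Fintype Loc] {N c : ℕ}

/-- Within a region of granularity `1 / (C * N)`, where `C` is the least common multiple of the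
rates, trajectories may be transferred with a given comparison of the cost at a given position. -/
lemma exists_follows_holds (hN : 0 < N) (hx : 0 ≤ x) (hx' : 0 ≤ x')
    (h : regionCode (A.rateLcm * (N * x)) = regionCode (A.rateLcm * (N * x')))
    (hle : ∀ k, clockBefore x (resetsOf e) y k ≤ y k) (r : Cmp) (n : ℕ)
    (hr : r.HoldsReal (A.cost i x e y n) c) :
    ∃ y', Follows N e x y x' y' ∧ r.HoldsReal (A.cost i x' e y' n) c := by
  have hN' : (0 : ℝ) < N := by exact_mod_cast hN
  have hx0 : 0 ≤ N * x := by positivity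
  have hx0' : 0 ≤ N * x' := by positivity
  have h' := regionCode_of_mul hx0 hx0' A.rateLcm_pos h
  have hy := (follows_iff_mem_timings (e := e) (y := y) hN rfl).1 ⟨hle, rfl, fun _ => rfl⟩
  have hs : ∀ k, (A.locCost i (e k).src : ℤ) ∈ slopes A.rateLcm := fun k => A.locCost_mem_slopes i _
  have hc : ((N * c : ℤ) : ℝ) = N * c := by push_cast; rfl
  have H1 := exists_timing_cost_le_and_lt (n := n) (c := N * c)
    (d := fun k => N * A.edgeCost i (e k)) A.rateLcm_pos hx0 hx0' h hs hy
  have H2 := exists_timing_le_cost_and_lt (n := n) (c := N * c)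
    (d := fun k => N * A.edgeCost i (e k)) A.rateLcm_pos hx0 hx0' h hs hy
  have H3 := exists_timing_cost_eq (n := n) (c := N * c)
    (d := fun k => N * A.edgeCost i (e k)) A.rateLcm_pos hx0 hx0' h hs hy
  rw [← cost_mul, hc] at H1 H2 H3
  cases r
  · obtain ⟨z, hz, hz'⟩ := H1.2 (mul_lt_mul_of_pos_left hr hN')
    obtain ⟨y', hy', rfl⟩ := exists_follows_of_timing hN h' hz
    rw [← cost_mul] at hz'
    exact ⟨y', hy', lt_of_mul_lt_mul_left hz' hN'.le⟩
  · obtain ⟨z, hz, hz'⟩ := H1.1 (mul_le_mul_of_nonneg_left hr hN'.le)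
    obtain ⟨y', hy', rfl⟩ := exists_follows_of_timing hN h' hz
    rw [← cost_mul] at hz'
    exact ⟨y', hy', le_of_mul_le_mul_left hz' hN'⟩
  · obtain ⟨z, hz, hz'⟩ := H3 (congrArg _ hr)
    obtain ⟨y', hy', rfl⟩ := exists_follows_of_timing hN h' hz
    rw [← cost_mul] at hz'
    exact ⟨y', hy', mul_left_cancel₀ hN'.ne' hz'⟩
  · obtain ⟨z, hz, hz'⟩ := H2.1 (mul_le_mul_of_nonneg_left hr hN'.le)
    obtain ⟨y', hy', rfl⟩ := exists_follows_of_timing hN h' hz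
    rw [← cost_mul] at hz'
    exact ⟨y', hy', le_of_mul_le_mul_left hz' hN'⟩
  · obtain ⟨z, hz, hz'⟩ := H2.2 (mul_lt_mul_of_pos_left hr hN')
    obtain ⟨y', hy', rfl⟩ := exists_follows_of_timing hN h' hz
    rw [← cost_mul] at hz'
    exact ⟨y', hy', lt_of_mul_lt_mul_left hz' hN'.le⟩

/-- Trajectories may be transferred within a region of granularity `1 / (C * N)` with a cost below
`c` at one position and above `c` at a later one. -/
lemma exists_follows_lt_lt (hN : 0 < N) (hx : 0 ≤ x) (hx' : 0 ≤ x')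
    (h : regionCode (A.rateLcm * (N * x)) = regionCode (A.rateLcm * (N * x')))
    (hle : ∀ k, clockBefore x (resetsOf e) y k ≤ y k) {m n : ℕ} (hmn : m ≤ n)
    (hm : A.cost i x e y m < c) (hn : c < A.cost i x e y n) :
    ∃ y', Follows N e x y x' y' ∧ A.cost i x' e y' m < c ∧ c < A.cost i x' e y' n := by
  have hN' : (0 : ℝ) < N := by exact_mod_cast hN
  have hx0 : 0 ≤ N * x := by positivity
  have hx0' : 0 ≤ N * x' := by positivity
  have h' := regionCode_of_mul hx0 hx0' A.rateLcm_pos h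
  have hy := (follows_iff_mem_timings (e := e) (y := y) hN rfl).1 ⟨hle, rfl, fun _ => rfl⟩
  have hs : ∀ k, (A.locCost i (e k).src : ℤ) ∈ slopes A.rateLcm := fun k => A.locCost_mem_slopes i _
  have hc : ((N * c : ℤ) : ℝ) = N * c := by push_cast; rfl
  have e1 : ∀ (x : ℝ) (z : ℕ → ℝ) (k : ℕ),
      timingCost (fun k => A.locCost i (e k).src) (fun k => N * A.edgeCost i (e k)) x
        (resetsOf e) z k = N * A.cost i (x / N) e (fun k => z k / N) k := fun x z k => by
    rw [cost_mul]
    congr 1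
    · field_simp
    · funext k; field_simp
  obtain ⟨z, hz, hz1, hz2⟩ := exists_timing_cost_lt_cost (m := m) (n := n) (c := N * c)
    (d := fun k => N * A.edgeCost i (e k)) A.rateLcm_pos hx0 hx0' h hs
    (fun x z hz => by
      rw [e1, e1]
      refine mul_le_mul_of_nonneg_left (cost_mono (fun k => ?_) hmn) hN'.le
      have := clockBefore_mul (N : ℝ) (x / N) (resetsOf e) (fun k => z k / N) k
      simp only [mul_div_cancel₀ _ hN'.ne'] at this
      rw [le_div_iff₀ hN', mul_comm, ← this]
      exact (hz k).1)
    (by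
      obtain ⟨y', hy', H⟩ := exists_follows_cost_lt_cost_iff A hN hx hx' h' hle
      refine ⟨_, (follows_iff_mem_timings hN h').1 hy', ?_⟩
      rw [← cost_mul, ← cost_mul]
      exact mul_lt_mul_of_pos_left ((H i m n hmn).2 (hm.trans hn)) hN')
    hy (by rw [← cost_mul, hc]; exact mul_lt_mul_of_pos_left hm hN')
    (by rw [← cost_mul, hc]; exact mul_lt_mul_of_pos_left hn hN')
  obtain ⟨y', hy', rfl⟩ := exists_follows_of_timing hN h' hz
  rw [← cost_mul, hc] at hz1 hz2
  exact ⟨y', hy', lt_of_mul_lt_mul_left hz1 hN'.le, lt_of_mul_lt_mul_left hz2 hN'.le⟩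

end Rates

end PTA
end PricedTimed

namespace PricedTimed

/-! ### Bounded sequences -/

lemma exists_forall_lt_add_of_bounded {W : ℕ → ℝ} {c : ℝ} (hc : ∀ n, W n < c)
    {η : ℝ} (hη : 0 < η) : ∃ n, ∀ m, W m < W n + η := by
  have hb : BddAbove (Set.range W) := ⟨c, by rintro _ ⟨n, rfl⟩; exact (hc n).le⟩
  obtain ⟨n, hn⟩ := exists_lt_of_lt_ciSup (sub_lt_self (⨆ n, W n) hη)
  exact ⟨n, fun m => by linarith [le_ciSup hb m]⟩

lemma exists_forall_le_of_bounded {f : ℕ → ℕ} {b : ℕ} (hb : ∀ k, f k ≤ b) :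
    ∃ k, ∀ l, f l ≤ f k := by
  obtain ⟨k, hk⟩ := Nat.sSup_mem (Set.range_nonempty f) ⟨b, by rintro _ ⟨k, rfl⟩; exact hb k⟩
  exact ⟨k, fun l => hk ▸ le_csSup ⟨b, by rintro _ ⟨k, rfl⟩; exact hb k⟩ ⟨l, rfl⟩⟩

/-- A monotone sequence of clock values eventually stays in one region, or above `M`. -/
lemma exists_guardEquiv_of_monotone (M : ℕ) {f : ℕ → ℝ} (hf : Monotone f) (h0 : ∀ k, 0 ≤ f k) :
    ∃ n, ∀ k ≥ n, GuardEquiv M (f n) (f k) := by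
  by_cases h : ∃ n, (M : ℝ) < f n
  · obtain ⟨n, hn⟩ := h
    exact ⟨n, fun k hk => guardEquiv_of_lt hn (hn.trans_le (hf hk))⟩
  · push Not at h
    have hb : ∀ k, regionCode (f k) ≤ 2 * M := fun k => by
      have := (lt_regionCode_iff (x := f k) (m := M)).not.2 (h k).not_gt
      omega
    obtain ⟨n, hn⟩ := exists_forall_le_of_bounded hb
    refine ⟨n, fun k hk m _ => ?_⟩
    exact (regionCode_eq_iff (h0 n) (h0 k)).1 ((regionCode_mono (hf hk)).antisymm (hn k)) m

namespace PTA

variable {X Loc : Type*} {p : ℕ} [Unique X] {A : PTA X Loc p} {i : Fin p} {x x' : ℝ}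
  {e : ℕ → Edge X Loc} {y : ℕ → ℝ} {N c : ℕ}

/-! ### Monotone constraints on the cost -/

variable {P : ℕ → Prop} {B : ℝ → Prop}

lemma exists_follows_forall_of_upper (hN : 0 < N) (hx : 0 ≤ x) (hx' : 0 ≤ x')
    (h : regionCode (N * x) = regionCode (N * x')) (hA : A.IsTrajectory x e y)
    (hB : ∀ u v, u ≤ v → B u → B v)
    (hK : ∀ n, B (A.cost i x e y n) → ∃ y', Follows N e x y x' y' ∧ B (A.cost i x' e y' n))
    (hP : ∀ n, P n → B (A.cost i x e y n)) :
    ∃ y', Follows N e x y x' y' ∧ ∀ n, P n → B (A.cost i x' e y' n) := by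
  classical
  by_cases hn : ∃ n, P n
  · obtain ⟨y', hf, h1⟩ := hK _ (hP _ (Nat.find_spec hn))
    exact ⟨y', hf, fun n hPn => hB _ _ (cost_mono hf.le (Nat.find_min' hn hPn)) h1⟩
  · obtain ⟨y', hf, -⟩ := exists_follows_cost_lt_cost_iff A hN hx hx' h hA.le
    exact ⟨y', hf, fun n hPn => absurd ⟨n, hPn⟩ hn⟩

lemma exists_follows_forall_of_lower (hN : 0 < N) (hx : 0 ≤ x) (hx' : 0 ≤ x')
    (h : regionCode (N * x) = regionCode (N * x')) (hA : A.IsTrajectory x e y)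
    (hB : ∀ u v, u ≤ v → B v → B u)
    (hK : ∀ n, B (A.cost i x e y n) → ∃ y', Follows N e x y x' y' ∧ B (A.cost i x' e y' n))
    (hP : ∀ n, P n → B (A.cost i x e y n)) :
    (∃ y', Follows N e x y x' y' ∧ ∀ n, P n → B (A.cost i x' e y' n)) ∨
      ∀ n, B (A.cost i x e y n) := by
  by_cases hb : BddAbove {n | P n}
  · left
    by_cases hn : {n | P n}.Nonempty
    · obtain ⟨y', hf, h1⟩ := hK _ (hP _ (Nat.sSup_mem hn hb))
      exact ⟨y', hf, fun n hPn => hB _ _ (cost_mono hf.le (le_csSup hb hPn)) h1⟩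
    · obtain ⟨y', hf, -⟩ := exists_follows_cost_lt_cost_iff A hN hx hx' h hA.le
      exact ⟨y', hf, fun n hPn => absurd ⟨n, hPn⟩ hn⟩
  · right
    intro n
    obtain ⟨m, hPm, hm⟩ := not_bddAbove_iff.1 hb n
    exact hB _ _ (cost_mono hA.le hm.le) (hP m hPm)

/-! ### Infinite runs of bounded cost -/

variable [Fintype Loc]

/-- If there are infinitely many resets, some location is entered with clock value `0` infinitely
often, and the given run returns there when its remaining cost is as small as needed. -/
lemma exists_cost_lt_of_frequently_reset (hN : 0 < N) (hx : 0 ≤ x) (hx' : 0 ≤ x')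
    (h : regionCode (A.rateLcm * (N * x)) = regionCode (A.rateLcm * (N * x')))
    (hA : A.IsTrajectory x e y) (hc : ∀ n, A.cost i x e y n < c)
    (hR : ∃ᶠ k in Filter.atTop, resetsOf e k) :
    ∃ e' y', A.IsTrajectory x' e' y' ∧ (e' 0).src = (e 0).src ∧ ∀ n, A.cost i x' e' y' n < c := by
  obtain ⟨q, hq⟩ : ∃ q, ∃ᶠ k in Filter.atTop, resetsOf e k ∧ (e (k + 1)).src = q := by
    by_contra! hq
    refine hR ((Filter.eventually_all.2 hq).mono fun k hk hRk => hk _ hRk rfl)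
  rw [Filter.frequently_atTop] at hq
  obtain ⟨k, -, hk, hkq⟩ := hq 0
  obtain ⟨y₁, hf, hlt⟩ := exists_follows_holds (c := c) hN hx hx' h hA.le .lt (k + 1) (hc (k + 1))
  obtain ⟨n, hn⟩ := exists_forall_lt_add_of_bounded hc (sub_pos.2 hlt)
  obtain ⟨l, hl, hl', hlq⟩ := hq n
  have ht := hA.tail (l + 1)
  rw [clockBefore_succ_of_reset hl', ← clockBefore_succ_of_reset (x := x') (y := y₁) hk] at ht
  obtain ⟨e', y', hA', hsrc, hle, hadd⟩ := (hf.isTrajectory hN hA hx hx').splice ht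
    (by rw [hkq]; exact hlq) i
  refine ⟨e', y', hA', hsrc, fun m => ?_⟩
  rcases le_total m (k + 1) with hm | hm
  · rw [hle m hm]
    exact (cost_mono hf.le hm).trans_lt hlt
  · obtain ⟨m, rfl⟩ := Nat.exists_eq_add_of_le hm
    rw [hadd, clockBefore_succ_of_reset hk, ← clockBefore_succ_of_reset (x := x) (y := y) hl']
    have h1 := cost_add (A := A) (i := i) (x := x) (e := e) (y := y) (l + 1) m
    have h2 := hn (l + 1 + m)
    have h3 := cost_mono (A := A) (i := i) hA.le (show n ≤ l + 1 by omega)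
    linarith

/-- If the clock is eventually never reset, its region is eventually constant, and the run may be
continued from there without delays. -/
lemma exists_cost_lt_of_eventually_not_reset (hN : 0 < N) (hx : 0 ≤ x) (hx' : 0 ≤ x')
    (h : regionCode (A.rateLcm * (N * x)) = regionCode (A.rateLcm * (N * x')))
    (hA : A.IsTrajectory x e y) (hc : ∀ n, A.cost i x e y n < c)
    (hR : ∀ᶠ k in Filter.atTop, ¬ resetsOf e k) :
    ∃ e' y', A.IsTrajectory x' e' y' ∧ (e' 0).src = (e 0).src ∧ ∀ n, A.cost i x' e' y' n < c := by
  have hN' : (0 : ℝ) < N := by exact_mod_cast hN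
  obtain ⟨n₁, hn₁⟩ := Filter.eventually_atTop.1 hR
  have hmono := cost_mono (i := i) (A := A) hA.le
  obtain ⟨n₂, hn₂⟩ := exists_forall_lt_add_of_bounded hc one_pos
  have hd : ∀ k ≥ n₂, A.edgeCost i (e k) = 0 := fun k hk => by
    have h1 := hn₂ (k + 1)
    have h2 := hmono hk
    rw [cost_succ] at h1
    have h3 := mul_nonneg (Nat.cast_nonneg (α := ℝ) (A.locCost i (e k).src))
      (sub_nonneg.2 (hA.le k))
    have h4 : (A.edgeCost i (e k) : ℝ) < 1 := by linarith
    exact Nat.lt_one_iff.1 (by exact_mod_cast h4)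
  obtain ⟨n₃, hn₃⟩ := exists_guardEquiv_of_monotone A.maxConst
    (f := fun k => clockBefore x (resetsOf e) y (n₁ + k))
    (monotone_nat_of_le_succ fun k => by
      rw [← add_assoc, clockBefore_succ_of_not (hn₁ _ (Nat.le_add_right _ _))]
      exact hA.le _) fun k => hA.nonneg hx _
  set n := n₁ + n₂ + n₃ with hn
  have heq : ∀ k ≥ n, GuardEquiv A.maxConst (clockBefore x (resetsOf e) y n)
      (clockBefore x (resetsOf e) y k) := fun k hk => by
    obtain ⟨l, rfl⟩ := Nat.exists_eq_add_of_le hk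
    have h1 := hn₃ (n₂ + n₃) (by omega)
    have h2 := hn₃ (n₂ + n₃ + l) (by omega)
    have e1 : n₁ + (n₂ + n₃) = n := by omega
    have e2 : n₁ + (n₂ + n₃ + l) = n + l := by omega
    beta_reduce at h1 h2
    rw [e1] at h1
    rw [e2] at h2
    exact h1.symm.trans h2
  obtain ⟨y₁, hf, hlt⟩ := exists_follows_holds (c := c) hN hx hx' h hA.le .lt n (hc n)
  have hA₁ := hf.isTrajectory hN hA hx hx'
  set z := clockBefore x' (resetsOf e) y₁ n with hz
  have hz0 : 0 ≤ z := hA₁.nonneg hx' n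
  have hzeq : ∀ k ≥ n, GuardEquiv A.maxConst (clockBefore x (resetsOf e) y k) z := fun k hk =>
    (heq k hk).symm.trans (guardEquiv_of_regionCode hN (hA.nonneg hx n) hz0
      (hf.regionCode_clockBefore n))
  have hclk : ∀ k, clockBefore z (resetsOf fun k => e (n + k)) (fun _ => z) k = z := fun k => by
    cases k with
    | zero => rfl
    | succ k => exact clockBefore_succ_of_not (hn₁ (n + k) (by omega))
  have ht : A.IsTrajectory z (fun k => e (n + k)) fun _ => z := by
    refine ⟨fun k => hA.src_succ (n + k), fun k => ?_⟩
    rw [hclk, hclk]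
    have hs := hA.step (n + k)
    have hy : y (n + k) = clockBefore x (resetsOf e) y (n + k + 1) :=
      (clockBefore_succ_of_not (hn₁ (n + k) (by omega))).symm
    rw [hy] at hs
    exact hs.congr (hA.nonneg hx _) hz0 (hA.nonneg hx _) hz0 le_rfl (hzeq _ (by omega))
      (hzeq _ (by omega)) (hzeq _ (by omega))
  obtain ⟨e', y', hA', hsrc, hle, hadd⟩ := hA₁.splice ht rfl i
  refine ⟨e', y', hA', hsrc, fun m => ?_⟩
  rcases le_total m n with hm | hm
  · rw [hle m hm]
    exact (cost_mono hf.le hm).trans_lt hlt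
  · obtain ⟨m, rfl⟩ := Nat.exists_eq_add_of_le hm
    have h0 : A.cost i z (fun k => e (n + k)) (fun _ => z) m = 0 := by
      rw [cost_eq_sum]
      refine Finset.sum_eq_zero fun k _ => ?_
      rw [hclk, sub_self, mul_zero, zero_add, hd _ (by omega), Nat.cast_zero]
    rw [hadd, h0, add_zero]
    exact hlt

lemma exists_forall_cost_lt (hN : 0 < N) (hx : 0 ≤ x) (hx' : 0 ≤ x')
    (h : regionCode (A.rateLcm * (N * x)) = regionCode (A.rateLcm * (N * x')))
    (hA : A.IsTrajectory x e y) (hc : ∀ n, A.cost i x e y n < c) :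
    ∃ e' y', A.IsTrajectory x' e' y' ∧ (e' 0).src = (e 0).src ∧ ∀ n, A.cost i x' e' y' n < c := by
  by_cases hR : ∃ᶠ k in Filter.atTop, resetsOf e k
  · exact exists_cost_lt_of_frequently_reset hN hx hx' h hA hc hR
  · exact exists_cost_lt_of_eventually_not_reset hN hx hx' h hA hc (Filter.not_frequently.1 hR)

lemma exists_forall_cost_le (hN : 0 < N) (hx : 0 ≤ x) (hx' : 0 ≤ x')
    (h : regionCode (A.rateLcm * (N * x)) = regionCode (A.rateLcm * (N * x')))
    (hA : A.IsTrajectory x e y) (hc : ∀ n, A.cost i x e y n ≤ c) :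
    ∃ e' y', A.IsTrajectory x' e' y' ∧ (e' 0).src = (e 0).src ∧ ∀ n, A.cost i x' e' y' n ≤ c := by
  by_cases hlt : ∀ n, A.cost i x e y n < c
  · obtain ⟨e', y', h1, h2, h3⟩ := exists_forall_cost_lt hN hx hx' h hA hlt
    exact ⟨e', y', h1, h2, fun n => (h3 n).le⟩
  -- once the bound is attained, the remaining moves are free, and stay so within a region
  push Not at hlt
  obtain ⟨n, hn⟩ := hlt
  obtain ⟨y₁, hf, hle₁⟩ := exists_follows_holds (c := c) hN hx hx' h hA.le .le n (hc n)
  have hA₁ := hf.isTrajectory hN hA hx hx'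
  obtain ⟨y₂, hf₂, hcost⟩ := exists_follows_cost_lt_cost_iff A hN (hA.nonneg hx n)
    (hA₁.nonneg hx' n) (hf.regionCode_clockBefore n) (hA.tail n).le
  obtain ⟨e', y', hA', hsrc, hle, hadd⟩ := hA₁.splice
    (hf₂.isTrajectory hN (hA.tail n) (hA.nonneg hx n) (hA₁.nonneg hx' n)) rfl i
  refine ⟨e', y', hA', hsrc, fun m => ?_⟩
  rcases le_total m n with hm | hm
  · rw [hle m hm]
    exact (cost_mono hf.le hm).trans hle₁
  · obtain ⟨m, rfl⟩ := Nat.exists_eq_add_of_le hm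
    have h1 := hcost i 0 m (Nat.zero_le m)
    rw [cost_zero, cost_zero] at h1
    have h2 := cost_add (A := A) (i := i) (x := x) (e := e) (y := y) n m
    have h3 := h1.not.2 (by linarith [hc (n + m)])
    rw [hadd]
    have h4 : A.cost i x' e y₁ n ≤ c := hle₁
    linarith

/-! ### Runs that violate a constraint -/

/-- A run along which the positions in `P` violate the cost constraint may be transferred within a
region of granularity `1 / (C * N)`: either along the same regions, or so that all its positions
violate the constraint. -/
lemma exists_forall_not_holds (hN : 0 < N) (hx : 0 ≤ x) (hx' : 0 ≤ x')
    (h : regionCode (A.rateLcm * (N * x)) = regionCode (A.rateLcm * (N * x')))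
    (hA : A.IsTrajectory x e y) (r : Cmp)
    (hP : ∀ n, P n → ¬ r.HoldsReal (A.cost i x e y n) c) :
    (∃ y', Follows N e x y x' y' ∧ ∀ n, P n → ¬ r.HoldsReal (A.cost i x' e y' n) c) ∨
      ∃ e' y', A.IsTrajectory x' e' y' ∧ (e' 0).src = (e 0).src ∧
        ∀ n, ¬ r.HoldsReal (A.cost i x' e' y' n) c := by
  have h' : regionCode (N * x) = regionCode (N * x') :=
    regionCode_of_mul (by positivity) (by positivity) A.rateLcm_pos h
  have hK := exists_follows_holds (i := i) (c := c) hN hx hx' h hA.le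
  cases r <;> simp only [Cmp.HoldsReal, not_lt, not_le] at hP ⊢
  · exact Or.inl (exists_follows_forall_of_upper (B := fun u => c ≤ u) hN hx hx' h' hA
      (fun u v huv hu => hu.trans huv) (hK .ge) hP)
  · exact Or.inl (exists_follows_forall_of_upper (B := fun u => c < u) hN hx hx' h' hA
      (fun u v huv hu => hu.trans_le huv) (hK .gt) hP)
  · have hmono := cost_mono (A := A) (i := i) hA.le
    by_cases hgt : ∃ n, P n ∧ c < A.cost i x e y n
    · classical
      left
      set n := Nat.find hgt with hn
      obtain ⟨hPn, hcn⟩ := Nat.find_spec hgt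
      have hbelow : ∀ m, P m → m < n → A.cost i x e y m < c := fun m hPm hm =>
        lt_of_le_of_ne (not_lt.1 fun h1 => Nat.find_min hgt hm ⟨hPm, h1⟩) (hP m hPm)
      by_cases hlt : ∃ m, P m ∧ m < n
      · -- `m` is the last position in `P` before `n`
        have hb : BddAbove {m | P m ∧ m < n} := ⟨n, fun m hm => hm.2.le⟩
        obtain ⟨hPm, hmn⟩ := Nat.sSup_mem (s := {m | P m ∧ m < n}) hlt hb
        obtain ⟨y', hf, h1, h2⟩ := exists_follows_lt_lt hN hx hx' h hA.le hmn.le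
          (hbelow _ hPm hmn) hcn
        refine ⟨y', hf, fun k hPk => ?_⟩
        rcases lt_or_ge k n with hk | hk
        · exact ((cost_mono hf.le (le_csSup hb ⟨hPk, hk⟩)).trans_lt h1).ne
        · exact (h2.trans_le (cost_mono hf.le hk)).ne'
      · obtain ⟨y', hf, h1⟩ := hK .gt n hcn
        refine ⟨y', hf, fun k hPk => ?_⟩
        have hk : n ≤ k := not_lt.1 fun hk => hlt ⟨k, hPk, hk⟩
        exact (lt_of_lt_of_le h1 (cost_mono hf.le hk)).ne'
    · push Not at hgt
      rcases exists_follows_forall_of_lower (B := fun u => u < c) hN hx hx' h' hA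
        (fun u v huv hu => huv.trans_lt hu) (hK .lt) fun n hPn =>
          lt_of_le_of_ne (hgt n hPn) (hP n hPn) with ⟨y', hf, h1⟩ | h1
      · exact Or.inl ⟨y', hf, fun n hPn => (h1 n hPn).ne⟩
      · obtain ⟨e', y', h2, h3, h4⟩ := exists_forall_cost_lt hN hx hx' h hA h1
        exact Or.inr ⟨e', y', h2, h3, fun n => (h4 n).ne⟩
  · rcases exists_follows_forall_of_lower (B := fun u => u < c) hN hx hx' h' hA
      (fun u v huv hu => huv.trans_lt hu) (hK .lt) hP with h1 | h1
    exacts [Or.inl h1, Or.inr (exists_forall_cost_lt hN hx hx' h hA h1)]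
  · rcases exists_follows_forall_of_lower (B := fun u => u ≤ c) hN hx hx' h' hA
      (fun u v huv hu => huv.trans hu) (hK .le) hP with h1 | h1
    exacts [Or.inl h1, Or.inr (exists_forall_cost_le hN hx hx' h hA h1)]

/-- Above the largest constant, a run may be shifted until its first reset. -/
lemma IsTrajectory.exists_shift (hA : A.IsTrajectory x e y) (hx : (A.maxConst : ℝ) < x)
    (hx' : (A.maxConst : ℝ) < x') :
    ∃ y', A.IsTrajectory x' e y' ∧
      (∀ k, clockBefore x' (resetsOf e) y' k = clockBefore x (resetsOf e) y k ∨
        (A.maxConst : ℝ) < clockBefore x (resetsOf e) y k ∧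
          (A.maxConst : ℝ) < clockBefore x' (resetsOf e) y' k) ∧
      ∀ i n, A.cost i x' e y' n = A.cost i x e y n := by
  have hM : (0 : ℝ) ≤ A.maxConst := Nat.cast_nonneg _
  obtain ⟨f, hf⟩ : ∃ f : ℝ → ℝ, ∀ z, f z = z + (x' - x) := ⟨_, fun _ => rfl⟩
  have hfx : f x = x' := by rw [hf]; ring
  have H := retime_cases f hA.le
  rw [hfx] at H
  have hd : ∀ k, retime f (resetsOf e) y k - clockBefore x' (resetsOf e) (retime f (resetsOf e) y) k
      = y k - clockBefore x (resetsOf e) y k := fun k => by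
    rcases H k with ⟨h1, h2⟩ | ⟨-, h1, h2⟩
    · rw [h1, h2]
    · rw [h1, h2, hf, hf]
      ring
  have hle : ∀ k, clockBefore x' (resetsOf e) (retime f (resetsOf e) y) k ≤
      retime f (resetsOf e) y k := fun k => by
    rw [← sub_nonneg, hd]
    exact sub_nonneg.2 (hA.le k)
  have hclk : ∀ k, clockBefore x' (resetsOf e) (retime f (resetsOf e) y) k =
      clockBefore x (resetsOf e) y k ∨ (A.maxConst : ℝ) < clockBefore x (resetsOf e) y k ∧
      (A.maxConst : ℝ) < clockBefore x' (resetsOf e) (retime f (resetsOf e) y) k := fun k => by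
    rcases H k with ⟨h1, -⟩ | ⟨h0, h1, -⟩
    · exact Or.inl h1
    · right
      rw [h1, hf]
      exact ⟨by linarith, by linarith⟩
  have hclkeq : ∀ k, GuardEquiv A.maxConst (clockBefore x (resetsOf e) y k)
      (clockBefore x' (resetsOf e) (retime f (resetsOf e) y) k) := fun k => by
    rcases hclk k with h1 | ⟨h1, h2⟩
    · rw [h1]
      exact GuardEquiv.refl _ _
    · exact guardEquiv_of_lt h1 h2
  have hyeq : ∀ k, GuardEquiv A.maxConst (y k) (retime f (resetsOf e) y k) := fun k => by
    rcases H k with ⟨-, h2⟩ | ⟨h0, -, h2⟩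
    · rw [h2]
      exact GuardEquiv.refl _ _
    · have := hA.le k
      rw [h2, hf]
      exact guardEquiv_of_lt (by linarith) (by linarith)
  have h1 := hA.nonneg (hM.trans hx.le)
  have h2 := clockBefore_nonneg (hM.trans hx'.le) hle
  exact ⟨_, ⟨hA.src_succ, fun k => (hA.step k).congr (h1 k) (h2 k) (h1 _) (h2 _) (hle k) (hclkeq k)
    (hyeq k) (hclkeq _)⟩, hclk, fun i n => cost_congr fun k _ => ⟨rfl, hd k⟩⟩

end PTA
end PricedTimed

namespace PricedTimed

/-! ### Until modalities and invariant predicates -/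

/-- The until modality with the constraint `r c`, where `W` is the accumulated cost, and `S` and `T`
are the sets of positions at which the two arguments hold. -/
def UntilOn (W : ℕ → ℝ) (S T : ℕ → Prop) (r : Cmp) (c : ℕ) : Prop :=
  ∃ π, 0 < π ∧ T π ∧ (∀ π', 0 < π' → π' < π → S π') ∧ r.HoldsReal (W π) c

lemma Cmp.weight_cases (r : Cmp) (c : ℕ) :
    r.weight c = 1 ∨ r.weight c = 0 ∧ c = 0 ∧ (r = .ge ∨ r = .gt) := by
  cases r <;> cases c <;> simp [Cmp.weight]

namespace PTA

variable {X Loc : Type*} {p : ℕ} {A : PTA X Loc p}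

section Invariant
variable [Fintype Loc]

/-- The truth of `P` is constant on the regions of granularity `1 / N`, and on the clock values
above all constants. -/
def RegionInvariant (A : PTA X Loc p) (N : ℕ) (P : Loc → ℝ → Prop) : Prop :=
  ∀ q z z', 0 ≤ z → 0 ≤ z' → (regionCode (N * z) = regionCode (N * z') ∨
    (A.maxConst : ℝ) < z ∧ (A.maxConst : ℝ) < z') → (P q z ↔ P q z')

lemma regionInvariant_of_imp {N : ℕ} {P : Loc → ℝ → Prop}
    (h : ∀ q z z', 0 ≤ z → 0 ≤ z' → (regionCode (N * z) = regionCode (N * z') ∨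
      (A.maxConst : ℝ) < z ∧ (A.maxConst : ℝ) < z') → P q z → P q z') :
    A.RegionInvariant N P := fun q z z' hz hz' H =>
  ⟨h q z z' hz hz' H, h q z' z hz' hz (H.imp Eq.symm And.symm)⟩

lemma RegionInvariant.of_dvd {N N' : ℕ} {P : Loc → ℝ → Prop} (h : A.RegionInvariant N P)
    (hN' : 0 < N') (hdvd : N ∣ N') : A.RegionInvariant N' P := by
  obtain ⟨a, rfl⟩ := hdvd
  refine fun q z z' hz hz' H => h q z z' hz hz' (H.imp_left fun h1 => ?_)
  rw [mul_comm N a] at h1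
  push_cast at h1
  rw [mul_assoc, mul_assoc] at h1
  exact regionCode_of_mul (by positivity) (by positivity) (Nat.pos_of_mul_pos_left hN') h1

lemma regionCode_pow_weight {N w : ℕ} {z z' : ℝ}
    (h : regionCode ((A.rateLcm ^ w * N : ℕ) * z) = regionCode ((A.rateLcm ^ w * N : ℕ) * z')) :
    regionCode ((A.rateLcm : ℝ) ^ w * (N * z)) = regionCode ((A.rateLcm : ℝ) ^ w * (N * z')) := by
  push_cast at h
  rwa [mul_assoc, mul_assoc] at h

end Invariant

variable [Unique X] {i : Fin p} {x x' : ℝ}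
  {e : ℕ → Edge X Loc} {y y' : ℕ → ℝ}

/-! ### Until along trajectories -/

lemma Run.exists_trajectory (ρ : A.Run) {q : Loc} (hx : 0 ≤ x)
    (h : ρ.state 0 = (q, fun _ => x.toNNReal)) : ∃ e y, A.IsTrajectory x e y ∧ (e 0).src = q ∧
      (∀ k, ρ.state k = ((e k).src, fun _ => (clockBefore x (resetsOf e) y k).toNNReal)) ∧
      ∀ i n, (ρ.prefixCost i n : ℝ) = A.cost i x e y n := by
  have hx0 : ((ρ.state 0).2 default : ℝ) = x := by rw [h, Real.coe_toNNReal x hx]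
  refine ⟨ρ.edge, fun k => (ρ.state k).2 default + ρ.dly k, ?_, ?_, fun k => ?_, fun i n => ?_⟩
  · rw [← hx0]
    exact ρ.isTrajectory
  · rw [ρ.src_edge, h]
  · rw [← hx0, ρ.clockBefore_eq, ρ.src_edge, Real.toNNReal_coe, ← valuation_eq]
  · rw [← hx0, ρ.prefixCost_eq]

/-- The until modality along a trajectory. -/
def UntilAt (A : PTA X Loc p) (S : Loc → ℝ → Prop) (i : Fin p) (r : Cmp) (c : ℕ)
    (T : Loc → ℝ → Prop) (x : ℝ) (e : ℕ → Edge X Loc) (y : ℕ → ℝ) : Prop :=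
  UntilOn (A.cost i x e y) (fun k => S (e k).src (clockBefore x (resetsOf e) y k))
    (fun k => T (e k).src (clockBefore x (resetsOf e) y k)) r c

lemma Run.until_iff (ρ : A.Run) (S T : State X Loc → Prop) (i : Fin p) (r : Cmp) (c : ℕ)
    (h : ∀ k, ρ.state k = ((e k).src, fun _ => (clockBefore x (resetsOf e) y k).toNNReal))
    (h' : ∀ i n, (ρ.prefixCost i n : ℝ) = A.cost i x e y n) :
    ρ.Until S i r c T ↔ A.UntilAt (fun q z => S (q, fun _ => z.toNNReal)) i r c
      (fun q z => T (q, fun _ => z.toNNReal)) x e y := by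
  simp only [Run.Until, UntilAt, UntilOn, Cmp.holds_iff, h', h, NNReal.coe_natCast]

/-- Some run from the location `q` and the clock value `x` satisfies the until modality, if `b` is
`True`; some run violates it, if `b` is `False`. -/
lemma exists_run_until_iff (S T : State X Loc → Prop) (i : Fin p) (r : Cmp) (c : ℕ) (q : Loc)
    (hx : 0 ≤ x) (b : Prop) :
    (∃ ρ : A.Run, ρ.state 0 = (q, fun _ => x.toNNReal) ∧ (ρ.Until S i r c T ↔ b)) ↔
    ∃ e y, A.IsTrajectory x e y ∧ (e 0).src = q ∧
      (A.UntilAt (fun q z => S (q, fun _ => z.toNNReal)) i r c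
        (fun q z => T (q, fun _ => z.toNNReal)) x e y ↔ b) := by
  constructor
  · rintro ⟨ρ, h0, h⟩
    obtain ⟨e, y, hA, hq, h1, h2⟩ := ρ.exists_trajectory hx h0
    exact ⟨e, y, hA, hq, (ρ.until_iff S T i r c h1 h2).symm.trans h⟩
  · rintro ⟨e, y, hA, rfl, h⟩
    obtain ⟨ρ, h1, h2⟩ := hA.exists_run hx
    exact ⟨ρ, h1 0, (ρ.until_iff S T i r c h1 h2).trans h⟩

/-! ### Invariance of until -/

variable {N : ℕ} {S T : Loc → ℝ → Prop} {r : Cmp} {c : ℕ}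

/-- A trivial constraint distinguishes at most between positive costs and cost `0`. -/
lemma exists_follows_holds_iff (hN : 0 < N) (hx : 0 ≤ x) (hx' : 0 ≤ x')
    (h : regionCode (N * x) = regionCode (N * x'))
    (hle : ∀ k, clockBefore x (resetsOf e) y k ≤ y k) (hr : r = .ge ∨ r = .gt) :
    ∃ y', Follows N e x y x' y' ∧
      ∀ n, r.HoldsReal (A.cost i x' e y' n) (0 : ℕ) ↔ r.HoldsReal (A.cost i x e y n) (0 : ℕ) := by
  obtain ⟨y', hf, H⟩ := exists_follows_cost_lt_cost_iff A hN hx hx' h hle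
  refine ⟨y', hf, fun n => ?_⟩
  rcases hr with rfl | rfl <;> simp only [Cmp.HoldsReal, Nat.cast_zero]
  · exact iff_of_true (cost_nonneg hf.le n) (cost_nonneg hle n)
  · simpa only [cost_zero] using H i 0 n (Nat.zero_le n)

variable [Fintype Loc]

lemma untilAt_congr (hS : A.RegionInvariant N S) (hT : A.RegionInvariant N T) (hx : 0 ≤ x)
    (hx' : 0 ≤ x') (hle : ∀ k, clockBefore x (resetsOf e) y k ≤ y k)
    (hle' : ∀ k, clockBefore x' (resetsOf e) y' k ≤ y' k)
    (h : ∀ k, regionCode (N * clockBefore x (resetsOf e) y k) =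
        regionCode (N * clockBefore x' (resetsOf e) y' k) ∨
      (A.maxConst : ℝ) < clockBefore x (resetsOf e) y k ∧
        (A.maxConst : ℝ) < clockBefore x' (resetsOf e) y' k) :
    A.UntilAt S i r c T x e y ↔
      UntilOn (A.cost i x e y) (fun k => S (e k).src (clockBefore x' (resetsOf e) y' k))
        (fun k => T (e k).src (clockBefore x' (resetsOf e) y' k)) r c := by
  have h1 := clockBefore_nonneg hx hle
  have h2 := clockBefore_nonneg hx' hle'
  simp only [UntilAt, hS _ _ _ (h1 _) (h2 _) (h _), hT _ _ _ (h1 _) (h2 _) (h _)]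

/-- The trajectories above all constants are shifts of each other. -/
lemma exists_untilAt_iff_of_lt (hS : A.RegionInvariant N S) (hT : A.RegionInvariant N T)
    (hA : A.IsTrajectory x e y) (hx : (A.maxConst : ℝ) < x) (hx' : (A.maxConst : ℝ) < x') :
    ∃ y', A.IsTrajectory x' e y' ∧
      (A.UntilAt S i r c T x' e y' ↔ A.UntilAt S i r c T x e y) := by
  have hM : (0 : ℝ) ≤ A.maxConst := Nat.cast_nonneg _
  obtain ⟨y', hA', hclk, hcost⟩ := hA.exists_shift hx hx'
  refine ⟨y', hA', ?_⟩
  rw [untilAt_congr hS hT (hM.trans hx.le) (hM.trans hx'.le) hA.le hA'.le fun k =>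
    (hclk k).imp_left fun h => by rw [h], UntilAt]
  rw [show A.cost i x' e y' = A.cost i x e y from funext fun n => hcost i n]

theorem regionInvariant_exists_untilAt (hN : 0 < N) (hS : A.RegionInvariant N S)
    (hT : A.RegionInvariant N T) (i : Fin p) (r : Cmp) (c : ℕ) :
    A.RegionInvariant (A.rateLcm ^ r.weight c * N) fun q z =>
      ∃ e y, A.IsTrajectory z e y ∧ (e 0).src = q ∧ A.UntilAt S i r c T z e y := by
  refine regionInvariant_of_imp ?_
  rintro q x x' hx hx' H ⟨e, y, hA, hq, hU⟩
  rcases H with h | ⟨h1, h2⟩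
  · replace h := regionCode_pow_weight h
    obtain ⟨π, hπ, hTπ, hSπ, hr⟩ := hU
    obtain ⟨y', hf, hr'⟩ : ∃ y', Follows N e x y x' y' ∧ r.HoldsReal (A.cost i x' e y' π) c := by
      rcases Cmp.weight_cases r c with hw | ⟨hw, rfl, hge⟩
      · rw [hw, pow_one] at h
        exact exists_follows_holds hN hx hx' h hA.le r π hr
      · rw [hw, pow_zero, one_mul, one_mul] at h
        obtain ⟨y', hf, H⟩ := exists_follows_holds_iff (A := A) (i := i) hN hx hx' h hA.le hge
        exact ⟨y', hf, (H π).2 hr⟩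
    have hA' := hf.isTrajectory hN hA hx hx'
    refine ⟨e, y', hA', hq, ?_⟩
    rw [untilAt_congr hS hT hx' hx hA'.le hA.le fun k =>
      Or.inl (hf.regionCode_clockBefore k).symm]
    exact ⟨π, hπ, hTπ, hSπ, hr'⟩
  · obtain ⟨y', hA', hiff⟩ := exists_untilAt_iff_of_lt hS hT hA h1 h2
    exact ⟨e, y', hA', hq, hiff.2 hU⟩

lemma not_untilOn_iff {W : ℕ → ℝ} {S T : ℕ → Prop} :
    ¬ UntilOn W S T r c ↔
      ∀ n, (0 < n ∧ T n ∧ ∀ k, 0 < k → k < n → S k) → ¬ r.HoldsReal (W n) c := by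
  simp only [UntilOn, not_exists, not_and, and_imp]

theorem regionInvariant_exists_not_untilAt (hN : 0 < N) (hS : A.RegionInvariant N S)
    (hT : A.RegionInvariant N T) (i : Fin p) (r : Cmp) (c : ℕ) :
    A.RegionInvariant (A.rateLcm ^ r.weight c * N) fun q z =>
      ∃ e y, A.IsTrajectory z e y ∧ (e 0).src = q ∧ ¬ A.UntilAt S i r c T z e y := by
  refine regionInvariant_of_imp ?_
  rintro q x x' hx hx' H ⟨e, y, hA, hq, hU⟩
  rcases H with h | ⟨h1, h2⟩
  · replace h := regionCode_pow_weight h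
    have hU' := not_untilOn_iff.1 hU
    rcases (show (∃ y', Follows N e x y x' y' ∧ ∀ n, (0 < n ∧
          T (e n).src (clockBefore x (resetsOf e) y n) ∧
          ∀ k, 0 < k → k < n → S (e k).src (clockBefore x (resetsOf e) y k)) →
          ¬ r.HoldsReal (A.cost i x' e y' n) c) ∨
        ∃ e' y', A.IsTrajectory x' e' y' ∧ (e' 0).src = (e 0).src ∧
          ∀ n, ¬ r.HoldsReal (A.cost i x' e' y' n) c by
      rcases Cmp.weight_cases r c with hw | ⟨hw, rfl, hge⟩
      · rw [hw, pow_one] at h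
        exact exists_forall_not_holds hN hx hx' h hA r hU'
      · rw [hw, pow_zero, one_mul, one_mul] at h
        obtain ⟨y', hf, H⟩ := exists_follows_holds_iff (A := A) (i := i) hN hx hx' h hA.le hge
        exact Or.inl ⟨y', hf, fun n hn => (H n).not.2 (hU' n hn)⟩) with
      ⟨y', hf, h1⟩ | ⟨e', y', hA', hsrc, h1⟩
    · have hA' := hf.isTrajectory hN hA hx hx'
      refine ⟨e, y', hA', hq, ?_⟩
      rw [untilAt_congr hS hT hx' hx hA'.le hA.le fun k =>
        Or.inl (hf.regionCode_clockBefore k).symm, not_untilOn_iff]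
      exact h1
    · exact ⟨e', y', hA', hsrc.trans hq, fun ⟨n, _, _, _, hr⟩ => h1 n hr⟩
  · obtain ⟨y', hA', hiff⟩ := exists_untilAt_iff_of_lt hS hT hA h1 h2
    exact ⟨e, y', hA', hq, hiff.not.2 hU⟩

end PTA

/-! ### Invariance of WCTL -/

theorem LabeledPTA.regionInvariant_sat {AP X Loc : Type*} [Unique X] [Fintype Loc] {p : ℕ}
    (A : LabeledPTA AP X Loc p) (Φ : Formula AP p) :
    A.RegionInvariant (A.rateLcm ^ Φ.height) fun q z => A.Sat Φ (q, fun _ => z.toNNReal) := by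
  have hC : ∀ k, 0 < A.rateLcm ^ k := fun k => pow_pos A.rateLcm_pos k
  induction Φ with
  | atom a => exact fun q z z' _ _ _ => Iff.rfl
  | neg φ ih => exact fun q z z' hz hz' H => not_congr (ih q z z' hz hz' H)
  | or φ ψ ih₁ ih₂ =>
    have h₁ := ih₁.of_dvd (hC _) (pow_dvd_pow _ (le_max_left φ.height ψ.height))
    have h₂ := ih₂.of_dvd (hC _) (pow_dvd_pow _ (le_max_right φ.height ψ.height))
    exact fun q z z' hz hz' H => or_congr (h₁ q z z' hz hz' H) (h₂ q z z' hz hz' H)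
  | EU φ i r c ψ ih₁ ih₂ =>
    have h₁ := ih₁.of_dvd (hC _) (pow_dvd_pow _ (le_max_left φ.height ψ.height))
    have h₂ := ih₂.of_dvd (hC _) (pow_dvd_pow _ (le_max_right φ.height ψ.height))
    have H := PTA.regionInvariant_exists_untilAt (hC _) h₁ h₂ i r c
    rw [← pow_add, add_comm] at H
    intro q z z' hz hz' h
    have e := fun z hz => PTA.exists_run_until_iff (A := A.toPTA) (x := z) (fun s => A.Sat φ s)
      (fun s => A.Sat ψ s) i r c q hz True
    simp only [iff_true] at e
    exact (e z hz).trans ((H q z z' hz hz' h).trans (e z' hz').symm)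
  | AU φ i r c ψ ih₁ ih₂ =>
    have h₁ := ih₁.of_dvd (hC _) (pow_dvd_pow _ (le_max_left φ.height ψ.height))
    have h₂ := ih₂.of_dvd (hC _) (pow_dvd_pow _ (le_max_right φ.height ψ.height))
    have H := PTA.regionInvariant_exists_not_untilAt (hC _) h₁ h₂ i r c
    rw [← pow_add, add_comm] at H
    intro q z z' hz hz' h
    have e := fun z hz => PTA.exists_run_until_iff (A := A.toPTA) (x := z) (fun s => A.Sat φ s)
      (fun s => A.Sat ψ s) i r c q hz False
    simp only [iff_false] at e
    have h3 := (e z hz).trans ((H q z z' hz hz' h).trans (e z' hz').symm)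
    rw [← not_iff_not]
    simpa only [LabeledPTA.Sat, not_forall, exists_prop] using h3

end PricedTimed

theorem mainTheorem2 {AP X Loc : Type*} [Unique X] [Fintype Loc] {p : ℕ}
    (A : PricedTimed.LabeledPTA AP X Loc p) (Φ : PricedTimed.Formula AP p) :
    ∃ (n : ℕ) (a : Fin (n + 1) → ℝ≥0),
      a 0 = 0 ∧ StrictMono a ∧
      (∀ (q : Loc) (i : Fin n) (v w : PricedTimed.Valuation X),
        a i.castSucc < v default → v default < a i.succ →
        a i.castSucc < w default → w default < a i.succ →
        (A.Sat Φ (q, v) ↔ A.Sat Φ (q, w))) ∧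
      (∀ (q : Loc) (v w : PricedTimed.Valuation X),
        a (Fin.last n) < v default → a (Fin.last n) < w default →
        (A.Sat Φ (q, v) ↔ A.Sat Φ (q, w))) ∧
      (∀ m ∈ A.consts, ∃ i, a i = m) ∧
      (∀ i, ∃ k : ℕ, a i = (k : ℝ≥0) / (A.rateLcm : ℝ≥0) ^ Φ.height) ∧
      a (Fin.last n) = A.maxConst ∧
      n ≤ A.maxConst * A.rateLcm ^ Φ.height + 1 := by
  set N := A.rateLcm ^ Φ.height with hN
  have hpos : 0 < N := pow_pos A.rateLcm_pos _
  have hpos' : (0 : ℝ≥0) < N := by exact_mod_cast hpos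
  have hne : (N : ℝ≥0) ≠ 0 := hpos'.ne'
  have hcast : (A.rateLcm : ℝ≥0) ^ Φ.height = N := by rw [hN]; push_cast; rfl
  have hsat : ∀ (q : Loc) (v w : PricedTimed.Valuation X),
      (PricedTimed.regionCode (N * v default) = PricedTimed.regionCode (N * w default) ∨
        (A.maxConst : ℝ) < v default ∧ (A.maxConst : ℝ) < w default) →
      (A.Sat Φ (q, v) ↔ A.Sat Φ (q, w)) := fun q v w h => by
    have := A.regionInvariant_sat Φ q (v default) (w default) (v default).coe_nonneg
      (w default).coe_nonneg h
    simpa only [Real.toNNReal_coe, ← PricedTimed.PTA.valuation_eq] using this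
  have hcode : ∀ (k : ℕ) (u : ℝ≥0), (k : ℝ≥0) / N < u → u < (k + 1 : ℕ) / N →
      PricedTimed.regionCode (N * u) = 2 * k + 1 := fun k u h1 h2 => by
    rw [div_lt_iff₀ hpos', mul_comm] at h1
    rw [lt_div_iff₀ hpos', mul_comm] at h2
    exact (PricedTimed.regionCode_eq_odd (by positivity)).2
      ⟨by exact_mod_cast h1, by exact_mod_cast h2⟩
  refine ⟨A.maxConst * N, fun i => (i : ℕ) / N, by simp, fun i j hij => ?_,
    fun q i v w h1 h2 h3 h4 => hsat q v w (Or.inl ?_), fun q v w h1 h2 => hsat q v w (Or.inr ?_),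
    fun m hm => ?_,
    fun i => ⟨i, by rw [hcast]⟩, ?_, Nat.le_succ _⟩
  · exact div_lt_div_of_pos_right (by exact_mod_cast hij) hpos'
  · rw [hcode i _ (by simpa using h1) (by simpa using h2),
      hcode i _ (by simpa using h3) (by simpa using h4)]
  · have e : ((A.maxConst * N : ℕ) : ℝ≥0) / N = A.maxConst := by
      push_cast
      exact mul_div_cancel_right₀ _ hne
    simp only [Fin.val_last, e] at h1 h2
    exact ⟨by exact_mod_cast h1, by exact_mod_cast h2⟩
  · have hm' : m ≤ A.maxConst := Finset.le_sup (f := id) hm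
    refine ⟨⟨m * N, Nat.lt_succ_of_le (Nat.mul_le_mul_right N hm')⟩, ?_⟩
    push_cast
    exact mul_div_cancel_right₀ _ hne
  · simp only [Fin.val_last]
    push_cast
    exact mul_div_cancel_right₀ _ hne
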